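/- Let $O=(0,0)$, $A_1=(1,0)$, $A_2=(\tfrac32,\tfrac{\sqrt3}2)$, $A_3=(1,\sqrt3)$, $A_4=(0,\sqrt3)$, $A_5=(-\tfrac12,\tfrac{\sqrt3}2)$ be the vertices of a regular hexagon $H\subset\mathbb R^2$ (a closed solid region) of side length $1$, put $A_0=O$, let $L$ be the boundary of $H$, and let $P$ be the uniform distribution on $L$, that is, the probability measure on $L$ with density $\tfrac16$ with respect to arc length. For $n\ge 1$, an optimal set of $n$-means for $P$ is a finite set $\alpha\subset\mathbb R^2$ with at most $n$ points that attains the infimum $$V_n(P)=\inf\Big\{\int\min_{a\in\beta}\|x-a\|^2\,dP(x)\;:\;\beta\subset\mathbb R^2,\ \operatorname{card}(\beta)\le n\Big\}.$$ Then, for all sufficiently large $n$, every optimal set $\alpha$ of $n$-means for $P$ contains six distinct points $c_0(\alpha),\dots,c_5(\alpha)$ (its corner points) that lie in the interior of $H$, and all other points of $\alpha$ lie on $L$. Moreover, the corner points can be labelled so that, for each $i\in\{0,\dots,5\}$, $c_i(\alpha)\to A_i$ as $n\to\infty$, uniformly over all optimal sets $\alpha$ of $n$-means: for every $\varepsilon>0$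 there is $M$ such that $\|c_i(\alpha)-A_i\|<\varepsilon$ for all $n\ge M$, all optimal sets $\alpha$ of $n$-means, and all $i$. -/

import Mathlib

open MeasureTheory Filter Topology

namespace HexQuant

/-- The Euclidean plane. -/
abbrev Plane : Type := EuclideanSpace ℝ (Fin 2)

/-- The vertices `O, A₁, A₂, A₃, A₄, A₅` of the regular hexagon with side length one, listed
counterclockwise. -/
noncomputable def vertex : Fin 6 → Plane :=
  ![!₂[0, 0], !₂[1, 0], !₂[3 / 2, √3 / 2], !₂[1, √3], !₂[0, √3], !₂[-1 / 2, √3 / 2]]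

/-- The boundary `L` of the hexagon: the union of its six sides. The index `j + 1` is taken in
`Fin 6`, so that the last side joins `A₅` to `O`. -/
def boundary : Set Plane :=
  ⋃ j : Fin 6, segment ℝ (vertex j) (vertex (j + 1))

/-- The (solid, closed) hexagonal region. -/
def region : Set Plane :=
  convexHull ℝ (Set.range vertex)

/-- The uniform distribution on the boundary of the hexagon: each side has length one and is
parametrized by arc length `t ∈ [0, 1]`, and the density with respect to arc length is `1 / 6`. -/
noncomputable def uniformDist : Measure Plane :=
  (6 : ENNReal)⁻¹ • ∑ j : Fin 6,
    (volume.restrict (Set.Icc (0 : ℝ) 1)).map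
      (fun t : ℝ => AffineMap.lineMap (vertex j) (vertex (j + 1)) t)

/-- The distortion error `∫ min_{a ∈ α} ‖x - a‖² dP(x)` of a finite set `α`, with value in
`[0, ∞]`; it is `∞` for `α = ∅` when `P ≠ 0`. -/
noncomputable def distortion (P : Measure Plane) (α : Finset Plane) : ENNReal :=
  ∫⁻ x, ⨅ a ∈ α, edist x a ^ 2 ∂P

/-- The `n`th quantization error `V_n(P)`. -/
noncomputable def quantizationError (P : Measure Plane) (n : ℕ) : ENNReal :=
  ⨅ (α : Finset Plane) (_ : α.card ≤ n), distortion P α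

/-- `α` is an optimal set of `n`-means for `P`: it has at most `n` points and attains the
infimum that defines the `n`th quantization error. -/
def IsOptimalMeans (P : Measure Plane) (n : ℕ) (α : Finset Plane) : Prop :=
  α.card ≤ n ∧ distortion P α = quantizationError P n

end HexQuant

/-! The argument is by exchange: an optimal set cannot be improved by moving one point, or by
trading a block of points for another block that is no larger. By the parallel axis theorem
(`setIntegral_norm_side_sub_sq`), the part of a side served by a point acts, up to a fixed variance,
like a mass `len` placed at its mean `mid`. Moving a point then becomes a comparison of finitely
many weighted points.

For large `n` every boundary point is within `1 / 24` of `α` (`exists_forall_norm_sub_assign_lt`).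
Nonadjacent sides are at distance at least `1`, so a point serves either one side or two adjacent
ones (`Mixed`). In the first case it is the mean of what it serves, hence on `L`; in the second it
is a centroid of masses on two sides meeting at 120°, hence interior and near the vertex. It remains
to see that each vertex has exactly one mixed point.

At most one (`mixed_unique`): no other point lies in the parallelogram spanned at the vertex by the
two means of a mixed point, since such a point would see these means under an obtuse angle and could
take over one of the parts. Two mixed points at one vertex either violate this, or their bisector
would have to separate the means in opposite orders on the two sides.

At least one (`exists_mixed`): mixed points are strictly nearest to their vertices, so they serve
intervals at the ends of sides. If a vertex had none, disjoint blocks of points would serve its two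
sides up to the far corners, at no less than the cost of equal cells (`interval_bounds`). Let `l` be
the cell length in the block with shorter cells. Moving one point of that block to the corner, to
serve `l / 2` on each side, saves about `l ^ 3 / 8` or more on one side and costs about `(1 / 24 +
13 / 192) * l ^ 3`, which is less (`false_of_no_corner`). -/

namespace HexQuant

/-! ### Geometry of the hexagon in oblique coordinates -/

/-- The direction of the `j`th side. -/
noncomputable def dir (j : Fin 6) : Plane := vertex (j + 1) - vertex j

/-- The arc length parametrization of the `j`th side. -/
noncomputable def side (j : Fin 6) (t : ℝ) : Plane :=
  AffineMap.lineMap (vertex j) (vertex (j + 1)) t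

lemma side_eq (j : Fin 6) (t : ℝ) : side j t = vertex j + t • dir j := by
  simp [side, dir, AffineMap.lineMap_apply, add_comm]

lemma vertex_succ (j : Fin 6) : vertex (j + 1) = vertex j + dir j := by
  simp [dir]

lemma side_eq_sub (j : Fin 6) (t : ℝ) : side j t = vertex (j + 1) - (1 - t) • dir j := by
  rw [side_eq, vertex_succ, sub_smul, one_smul]; abel

lemma inner_dir_self (j : Fin 6) : inner ℝ (dir j) (dir j) = 1 := by
  have h3 : √3 * √3 = 3 := Real.mul_self_sqrt (by norm_num)
  have h : |√3| = √3 := abs_of_nonneg (Real.sqrt_nonneg 3)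
  rw [PiLp.inner_apply, Fin.sum_univ_two]
  fin_cases j <;> simp [dir, vertex, h] <;> linarith

lemma inner_dir_succ (j : Fin 6) : inner ℝ (dir j) (dir (j + 1)) = 1 / 2 := by
  have h3 : √3 * √3 = 3 := Real.mul_self_sqrt (by norm_num)
  fin_cases j <;> simp [dir, vertex, PiLp.inner_apply, Fin.sum_univ_two] <;> linarith

lemma inner_dir_add_two (j : Fin 6) : inner ℝ (dir j) (dir (j + 1 + 1)) = -1 / 2 := by
  have h3 : √3 * √3 = 3 := Real.mul_self_sqrt (by norm_num)
  fin_cases j <;> simp [dir, vertex, PiLp.inner_apply, Fin.sum_univ_two] <;> linarith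

lemma norm_dir (j : Fin 6) : ‖dir j‖ = 1 := by
  rw [norm_eq_sqrt_real_inner, inner_dir_self, Real.sqrt_one]

lemma dir_cross (j : Fin 6) :
    dir j 0 * dir (j + 1) 1 - dir j 1 * dir (j + 1) 0 = √3 / 2 := by
  fin_cases j <;> simp [dir, vertex] <;> ring

lemma eq_zero_of_inner_dir {r : Plane} {i : Fin 6} (h1 : inner ℝ (dir i) r = 0)
    (h2 : inner ℝ (dir (i + 1)) r = 0) : r = 0 := by
  rw [PiLp.inner_apply, Fin.sum_univ_two] at h1 h2
  simp only [RCLike.inner_apply, conj_trivial] at h1 h2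
  have hd := dir_cross i
  have h3 : √3 / 2 ≠ 0 := by positivity
  ext k
  fin_cases k
  · apply mul_left_cancel₀ h3
    rw [← hd]
    simp only [Fin.zero_eta, PiLp.zero_apply]
    linear_combination dir (i + 1) 1 * h1 - dir i 1 * h2
  · apply mul_left_cancel₀ h3
    rw [← hd]
    simp only [Fin.mk_one, PiLp.zero_apply]
    linear_combination dir i 0 * h2 - dir (i + 1) 0 * h1

/-- Oblique coordinates at the vertex where the sides `i` and `i + 1` meet. -/
noncomputable def cornerPt (i : Fin 6) (x y : ℝ) : Plane :=
  vertex (i + 1) - x • dir i + y • dir (i + 1)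

lemma side_eq_cornerPt (i : Fin 6) (t : ℝ) : side i t = cornerPt i (1 - t) 0 := by
  simp [side_eq_sub, cornerPt]

lemma side_succ_eq_cornerPt (i : Fin 6) (t : ℝ) : side (i + 1) t = cornerPt i 0 t := by
  simp [side_eq, cornerPt]

lemma vertex_eq_cornerPt (i : Fin 6) : vertex (i + 1) = cornerPt i 0 0 := by
  simp [cornerPt]

lemma norm_comb_sq (i : Fin 6) (x y : ℝ) :
    ‖x • dir i + y • dir (i + 1)‖ ^ 2 = x ^ 2 + y ^ 2 + x * y := by
  rw [← real_inner_self_eq_norm_sq]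
  simp only [inner_add_left, inner_add_right, inner_smul_left, inner_smul_right, inner_dir_self,
    inner_dir_succ, real_inner_comm (dir i) (dir (i + 1)), conj_trivial]
  ring

/-- The mixed term is negative because the unit vectors `-dir i` and `dir (i + 1)` that leave the
vertex along its sides make an angle of 120°. -/
lemma norm_cornerPt_sub_sq (i : Fin 6) (x y x' y' : ℝ) :
    ‖cornerPt i x y - cornerPt i x' y'‖ ^ 2
      = (x - x') ^ 2 + (y - y') ^ 2 - (x - x') * (y - y') := by
  have : cornerPt i x y - cornerPt i x' y' = (x' - x) • dir i + (y - y') • dir (i + 1) := by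
    simp only [cornerPt, sub_smul]; abel
  rw [this, norm_comb_sq]; ring

lemma norm_side_sub_side_sq (j : Fin 6) (s t : ℝ) :
    ‖side j s - side j t‖ ^ 2 = (s - t) ^ 2 := by
  rw [side_eq_cornerPt, side_eq_cornerPt, norm_cornerPt_sub_sq]; ring

lemma norm_side_sub_side (j : Fin 6) (s t : ℝ) : ‖side j s - side j t‖ = |s - t| := by
  rw [← Real.sqrt_sq_eq_abs, ← norm_side_sub_side_sq j, Real.sqrt_sq (norm_nonneg _)]

lemma side_injective (j : Fin 6) : Function.Injective (side j) := fun s t h => by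
  have := norm_side_sub_side j s t
  rw [h, sub_self, norm_zero] at this
  exact sub_eq_zero.1 (abs_eq_zero.1 this.symm)

lemma continuous_side (j : Fin 6) : Continuous (side j) := by
  have : side j = fun t => vertex j + t • dir j := funext (side_eq j)
  rw [this]; fun_prop

lemma side_mem_boundary (j : Fin 6) {t : ℝ} (ht : t ∈ Set.Icc (0 : ℝ) 1) :
    side j t ∈ boundary := by
  refine Set.mem_iUnion.2 ⟨j, ?_⟩
  rw [segment_eq_image_lineMap]
  exact ⟨t, ht, rfl⟩

/-- The coefficients come from inverting the Gram matrix of `dir i` and `dir (i + 1)`, whose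
determinant is `3 / 4`. -/
lemma exists_eq_cornerPt (i : Fin 6) (p : Plane) :
    p = cornerPt i
      (4 / 3 * (inner ℝ (dir (i + 1)) (p - vertex (i + 1)) / 2 - inner ℝ (dir i) (p - vertex (i + 1))))
      (4 / 3 * (inner ℝ (dir (i + 1)) (p - vertex (i + 1))
        - inner ℝ (dir i) (p - vertex (i + 1)) / 2)) := by
  rw [← sub_eq_zero]
  set u := p - vertex (i + 1) with hu
  set I := inner ℝ (dir i) u
  set J := inner ℝ (dir (i + 1)) u
  have : p - cornerPt i (4 / 3 * (J / 2 - I)) (4 / 3 * (J - I / 2))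
      = u + (4 / 3 * (J / 2 - I)) • dir i - (4 / 3 * (J - I / 2)) • dir (i + 1) := by
    simp only [cornerPt, hu]; abel
  rw [this]
  apply eq_zero_of_inner_dir (i := i)
  · simp only [inner_sub_right, inner_add_right, inner_smul_right, inner_dir_self, inner_dir_succ]
    ring
  · simp only [inner_sub_right, inner_add_right, inner_smul_right, inner_dir_self,
      real_inner_comm (dir i) (dir (i + 1)), inner_dir_succ]
    ring

lemma cornerPt_mem_region (i : Fin 6) {x y : ℝ} (hx : 0 ≤ x) (hy : 0 ≤ y) (hxy : x + y ≤ 1) :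
    cornerPt i x y ∈ region := by
  have hv : ∀ j, vertex j ∈ region := fun j => subset_convexHull ℝ _ ⟨j, rfl⟩
  have h := (convex_convexHull ℝ (Set.range vertex)).sum_mem (t := Finset.univ)
    (w := ![1 - x - y, x, y]) (z := ![vertex (i + 1), vertex i, vertex (i + 1 + 1)])
    (by intro k _; fin_cases k <;> simp <;> linarith)
    (by simp only [Fin.sum_univ_three, Matrix.cons_val_zero, Matrix.cons_val_one, Matrix.cons_val]
        ring)
    (by intro k _; fin_cases k; exacts [hv (i + 1), hv i, hv (i + 1 + 1)])
  have e : cornerPt i x y = (1 - x - y) • vertex (i + 1) + x • vertex i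
      + y • vertex (i + 1 + 1) := by
    rw [vertex_succ (i + 1), cornerPt, vertex_succ i]
    module
  rw [e]
  simpa [Fin.sum_univ_three, region] using h

lemma cornerPt_mem_interior (i : Fin 6) {x y : ℝ} (hx : 0 < x) (hy : 0 < y) (hxy : x + y < 1) :
    cornerPt i x y ∈ interior region := by
  let X : Plane → ℝ := fun p =>
    4 / 3 * (inner ℝ (dir (i + 1)) (p - vertex (i + 1)) / 2 - inner ℝ (dir i) (p - vertex (i + 1)))
  let Y : Plane → ℝ := fun p =>
    4 / 3 * (inner ℝ (dir (i + 1)) (p - vertex (i + 1)) - inner ℝ (dir i) (p - vertex (i + 1)) / 2)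
  have hX : Continuous X := by fun_prop
  have hY : Continuous Y := by fun_prop
  have e : cornerPt i x y - vertex (i + 1) = y • dir (i + 1) - x • dir i := by
    simp only [cornerPt]; abel
  have hXv : X (cornerPt i x y) = x := by
    simp only [X]
    rw [e]
    simp only [inner_sub_right, inner_smul_right, inner_dir_self, inner_dir_succ,
      real_inner_comm (dir i) (dir (i + 1))]
    ring
  have hYv : Y (cornerPt i x y) = y := by
    simp only [Y]
    rw [e]
    simp only [inner_sub_right, inner_smul_right, inner_dir_self, inner_dir_succ,
      real_inner_comm (dir i) (dir (i + 1))]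
    ring
  refine mem_interior.2 ⟨{p | 0 < X p ∧ 0 < Y p ∧ X p + Y p < 1}, ?_, ?_, ?_⟩
  · rintro p ⟨h1, h2, h3⟩
    rw [exists_eq_cornerPt i p]
    exact cornerPt_mem_region i h1.le h2.le h3.le
  · exact (isOpen_lt continuous_const hX).inter
      ((isOpen_lt continuous_const hY).inter (isOpen_lt (hX.add hY) continuous_const))
  · simp only [Set.mem_ofPred_eq, hXv, hYv]
    exact ⟨hx, hy, hxy⟩

/-- The sides `i` and `j` are distinct and not adjacent. -/
def FarSides (i j : Fin 6) : Prop := j = i + 1 + 1 ∨ j = i + 1 + 1 + 1 ∨ i = j + 1 + 1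

instance (i j : Fin 6) : Decidable (FarSides i j) := by unfold FarSides; infer_instance

/-- A strip of width one orthogonal to the side between them separates the two sides: relative to
`vertex (i + 1)`, the functional `inner ℝ (dir (i + 1))` is at most `0` on side `i` and at least `1`
on the next two sides but one. -/
lemma one_le_dist_of_farSides {i j : Fin 6} (h : FarSides i j) {s t : ℝ}
    (hs : s ∈ Set.Icc (0 : ℝ) 1) (ht : t ∈ Set.Icc (0 : ℝ) 1) :
    1 ≤ dist (side i s) (side j t) := by
  have key : ∀ (i : Fin 6) (p q : Plane), inner ℝ (dir i) p ≤ 0 → 1 ≤ inner ℝ (dir i) q →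
      1 ≤ ‖q - p‖ := fun i p q hp hq => by
    have h1 := real_inner_le_norm (dir i) (q - p)
    rw [norm_dir, one_mul, inner_sub_right] at h1
    linarith
  have two : ∀ (i : Fin 6) {s t : ℝ}, s ∈ Set.Icc (0 : ℝ) 1 → t ∈ Set.Icc (0 : ℝ) 1 →
      1 ≤ ‖side (i + 1 + 1) t - side i s‖ := fun i s t hs ht => by
    have := key (i + 1) (-(1 - s) • dir i) (dir (i + 1) + t • dir (i + 1 + 1))
      (by rw [inner_smul_right, real_inner_comm, inner_dir_succ]; linarith [hs.2])
      (by rw [inner_add_right, inner_smul_right, inner_dir_self, inner_dir_succ]; linarith [ht.1])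
    have e : side (i + 1 + 1) t - side i s = dir (i + 1) + t • dir (i + 1 + 1)
        - -(1 - s) • dir i := by
      rw [side_eq, side_eq_sub, vertex_succ (i + 1)]; module
    rwa [e]
  rcases h with rfl | rfl | rfl
  · rw [dist_comm, dist_eq_norm]; exact two i hs ht
  · have := key (i + 1) (-(1 - s) • dir i)
      (dir (i + 1) + dir (i + 1 + 1) + t • dir (i + 1 + 1 + 1))
      (by rw [inner_smul_right, real_inner_comm, inner_dir_succ]; linarith [hs.2])
      (by rw [inner_add_right, inner_add_right, inner_smul_right, inner_dir_self, inner_dir_succ,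
            inner_dir_add_two]; linarith [ht.2])
    rw [dist_comm, dist_eq_norm]
    have e : side (i + 1 + 1 + 1) t - side i s = dir (i + 1) + dir (i + 1 + 1)
        + t • dir (i + 1 + 1 + 1) - -(1 - s) • dir i := by
      rw [side_eq, side_eq_sub, vertex_succ (i + 1 + 1), vertex_succ (i + 1)]; module
    rwa [e]
  · rw [dist_eq_norm]; exact two j ht hs

/-! ### Nearest point maps and the cost as a sum over sides -/

/-- `f` is a measurable map that sends every point to a nearest point of `α`. -/
def IsNearest (α : Finset Plane) (f : Plane → Plane) : Prop :=
  Measurable f ∧ ∀ x, f x ∈ α ∧ ∀ b ∈ α, ‖x - f x‖ ≤ ‖x - b‖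

lemma exists_isNearest {α : Finset Plane} (hα : α.Nonempty) : ∃ f, IsNearest α f := by
  induction hα using Finset.Nonempty.cons_induction with
  | singleton a => exact ⟨fun _ => a, measurable_const, fun x => by simp⟩
  | cons a s h hs ih =>
    obtain ⟨f, hf, hfx⟩ := ih
    classical
    refine ⟨fun x => if ‖x - a‖ ≤ ‖x - f x‖ then a else f x,
      Measurable.ite (measurableSet_le (by fun_prop) (by fun_prop)) measurable_const hf, ?_⟩
    intro x
    obtain ⟨h1, h2⟩ := hfx x
    dsimp only
    split_ifs with hx
    · refine ⟨by simp, fun b hb => ?_⟩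
      rcases Finset.mem_cons.1 hb with rfl | hb
      · exact le_rfl
      · exact hx.trans (h2 b hb)
    · refine ⟨by simp [h1], fun b hb => ?_⟩
      rcases Finset.mem_cons.1 hb with rfl | hb
      · exact (not_le.1 hx).le
      · exact h2 b hb

open Classical in
/-- A measurable nearest point map for `α` (constant for empty `α`). -/
noncomputable def assign (α : Finset Plane) : Plane → Plane :=
  if h : α.Nonempty then (exists_isNearest h).choose else fun _ => 0

lemma isNearest_assign {α : Finset Plane} (hα : α.Nonempty) : IsNearest α (assign α) := by
  rw [assign, dif_pos hα]
  exact (exists_isNearest hα).choose_spec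

/-- The quadratic cost of serving the `j`th side by the map `g`. -/
noncomputable def sideCost (j : Fin 6) (g : ℝ → Plane) : ℝ :=
  ∫ t in Set.Icc (0 : ℝ) 1, ‖side j t - g t‖ ^ 2

lemma measurable_side (j : Fin 6) : Measurable (side j) := (continuous_side j).measurable

lemma exists_bound (j : Fin 6) (β : Finset Plane) :
    ∃ C : ℝ, ∀ t ∈ Set.Icc (0 : ℝ) 1, ∀ b ∈ β, ‖side j t - b‖ ^ 2 ≤ C := by
  have h : ∀ b : Plane, ∃ C : ℝ, ∀ t ∈ Set.Icc (0 : ℝ) 1, ‖side j t - b‖ ^ 2 ≤ C := fun b => by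
    have hc : ContinuousOn (fun t => ‖side j t - b‖ ^ 2) (Set.Icc (0 : ℝ) 1) := by
      have := continuous_side j
      fun_prop
    obtain ⟨C, hC⟩ := isCompact_Icc.exists_bound_of_continuousOn hc
    exact ⟨C, fun t ht => (le_abs_self _).trans (hC t ht)⟩
  choose C hC using h
  refine ⟨∑ b ∈ β, |C b|, fun t ht b hb => (hC b t ht).trans ((le_abs_self _).trans ?_)⟩
  exact Finset.single_le_sum (f := fun b => |C b|) (fun _ _ => abs_nonneg _) hb

lemma integrableOn_cost (j : Fin 6) {β : Finset Plane} {g : ℝ → Plane} (hg : Measurable g)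
    (hβ : ∀ t ∈ Set.Icc (0 : ℝ) 1, g t ∈ β) :
    IntegrableOn (fun t => ‖side j t - g t‖ ^ 2) (Set.Icc (0 : ℝ) 1) := by
  obtain ⟨C, hC⟩ := exists_bound j β
  have hm := measurable_side j
  refine Measure.integrableOn_of_bounded (M := C) (by simp)
    (Measurable.aestronglyMeasurable (by fun_prop)) ?_
  refine (ae_restrict_iff' measurableSet_Icc).2 (Eventually.of_forall fun t ht => ?_)
  rw [Real.norm_of_nonneg (by positivity)]
  exact hC t ht _ (hβ t ht)

lemma sideCost_nonneg (j : Fin 6) (g : ℝ → Plane) : 0 ≤ sideCost j g :=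
  integral_nonneg fun _ => by positivity

lemma distortion_uniformDist (α : Finset Plane) : distortion uniformDist α
    = 6⁻¹ * ∑ j, ∫⁻ t in Set.Icc (0 : ℝ) 1, ⨅ a ∈ α, edist (side j t) a ^ 2 := by
  have hm : Measurable fun x : Plane => ⨅ a ∈ α, edist x a ^ 2 :=
    Measurable.biInf _ α.countable_toSet fun a _ => by fun_prop
  rw [distortion, uniformDist, lintegral_smul_measure, smul_eq_mul,
    lintegral_finsetSum_measure]
  congr 1
  refine Finset.sum_congr rfl fun j _ => ?_
  exact lintegral_map hm (measurable_side j)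

lemma edist_sq_eq (x y : Plane) : edist x y ^ 2 = ENNReal.ofReal (‖x - y‖ ^ 2) := by
  rw [edist_dist, dist_eq_norm, ENNReal.ofReal_pow (norm_nonneg _)]

lemma lintegral_cost (j : Fin 6) {β : Finset Plane} {g : ℝ → Plane} (hg : Measurable g)
    (hβ : ∀ t ∈ Set.Icc (0 : ℝ) 1, g t ∈ β) :
    ∫⁻ t in Set.Icc (0 : ℝ) 1, edist (side j t) (g t) ^ 2 = ENNReal.ofReal (sideCost j g) := by
  simp only [edist_sq_eq]
  rw [sideCost, ofReal_integral_eq_lintegral_ofReal (integrableOn_cost j hg hβ)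
    (Eventually.of_forall fun _ => by positivity)]

lemma six_inv_mul_sum (c : Fin 6 → ℝ) (hc : ∀ j, 0 ≤ c j) :
    6⁻¹ * ∑ j, ENNReal.ofReal (c j) = ENNReal.ofReal (6⁻¹ * ∑ j, c j) := by
  rw [ENNReal.ofReal_mul (by norm_num), ENNReal.ofReal_sum_of_nonneg fun j _ => hc j,
    ENNReal.ofReal_inv_of_pos (by norm_num)]
  simp

/-- Here `g` need not choose nearest points, so competitors can be estimated without knowing their
Voronoi cells. -/
lemma distortion_le {β : Finset Plane} {g : Fin 6 → ℝ → Plane} (hg : ∀ j, Measurable (g j))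
    (hβ : ∀ j, ∀ t ∈ Set.Icc (0 : ℝ) 1, g j t ∈ β) :
    distortion uniformDist β ≤ ENNReal.ofReal (6⁻¹ * ∑ j, sideCost j (g j)) := by
  rw [distortion_uniformDist, ← six_inv_mul_sum _ fun j => sideCost_nonneg j _]
  gcongr with j
  rw [← lintegral_cost j (hg j) (hβ j)]
  refine setLIntegral_mono' measurableSet_Icc fun t ht => ?_
  exact iInf₂_le (g j t) (hβ j t ht)

lemma distortion_eq {α : Finset Plane} (hα : α.Nonempty) : distortion uniformDist α
    = ENNReal.ofReal (6⁻¹ * ∑ j, sideCost j fun t => assign α (side j t)) := by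
  obtain ⟨hm, hn⟩ := isNearest_assign hα
  rw [distortion_uniformDist, ← six_inv_mul_sum _ fun j => sideCost_nonneg j _]
  congr 1
  refine Finset.sum_congr rfl fun j _ => ?_
  rw [← lintegral_cost j (g := fun t => assign α (side j t))
    (hm.comp (measurable_side j)) (β := α) fun t _ => (hn _).1]
  congr 1
  ext t
  refine le_antisymm (iInf₂_le _ (hn _).1) (le_iInf₂ fun a ha => ?_)
  simp only [edist_sq_eq]
  have := (hn (side j t)).2 a ha
  gcongr

lemma distortion_empty : distortion uniformDist ∅ = ⊤ := by
  simp [distortion_uniformDist, ENNReal.mul_top]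

lemma nonempty_of_isOptimalMeans {n : ℕ} (hn : 1 ≤ n) {α : Finset Plane}
    (h : IsOptimalMeans uniformDist n α) : α.Nonempty := by
  rw [Finset.nonempty_iff_ne_empty]
  rintro rfl
  have h1 := h.2
  rw [distortion_empty] at h1
  have h2 : quantizationError uniformDist n ≤ distortion uniformDist {0} :=
    iInf₂_le _ (by simpa using hn)
  rw [← h1, distortion_eq (by simp)] at h2
  exact ENNReal.ofReal_ne_top (top_le_iff.1 h2)

lemma sum_sideCost_le {n : ℕ} {α : Finset Plane} (hα : α.Nonempty)
    (h : IsOptimalMeans uniformDist n α) {β : Finset Plane} (hcard : β.card ≤ n)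
    {g : Fin 6 → ℝ → Plane} (hg : ∀ j, Measurable (g j))
    (hβ : ∀ j, ∀ t ∈ Set.Icc (0 : ℝ) 1, g j t ∈ β) :
    ∑ j, sideCost j (fun t => assign α (side j t)) ≤ ∑ j, sideCost j (g j) := by
  have h1 : distortion uniformDist α ≤ distortion uniformDist β := by
    rw [h.2, quantizationError]; exact iInf₂_le β hcard
  have h2 := h1.trans (distortion_le hg hβ)
  rw [distortion_eq hα, ENNReal.ofReal_le_ofReal_iff
    (mul_nonneg (by norm_num) (Finset.sum_nonneg fun j _ => sideCost_nonneg j _))] at h2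
  linarith

/-! ### Cells, their means, and exchange inequalities -/

/-- The set of parameters on the `j`th side that are served by `a ∈ α`. -/
def cell (α : Finset Plane) (a : Plane) (j : Fin 6) : Set ℝ :=
  {t ∈ Set.Icc (0 : ℝ) 1 | assign α (side j t) = a}

/-- The length of the part of the `j`th side that is served by `a ∈ α`. -/
noncomputable def len (α : Finset Plane) (a : Plane) (j : Fin 6) : ℝ := volume.real (cell α a j)

/-- The mean parameter of the part of the `j`th side that is served by `a ∈ α`. -/
noncomputable def mid (α : Finset Plane) (a : Plane) (j : Fin 6) : ℝ :=
  ⨍ t in cell α a j, t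

lemma cell_subset (α : Finset Plane) (a : Plane) (j : Fin 6) :
    cell α a j ⊆ Set.Icc (0 : ℝ) 1 := fun _ h => h.1

lemma measurable_assign {α : Finset Plane} (hα : α.Nonempty) : Measurable (assign α) :=
  (isNearest_assign hα).1

lemma measurable_assign_side {α : Finset Plane} (hα : α.Nonempty) (j : Fin 6) :
    Measurable fun t => assign α (side j t) :=
  (measurable_assign hα).comp (measurable_side j)

lemma assign_mem {α : Finset Plane} (hα : α.Nonempty) (x : Plane) : assign α x ∈ α :=
  ((isNearest_assign hα).2 x).1

lemma norm_sub_assign_le {α : Finset Plane} (x : Plane) {b : Plane} (hb : b ∈ α) :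
    ‖x - assign α x‖ ≤ ‖x - b‖ :=
  ((isNearest_assign ⟨b, hb⟩).2 x).2 b hb

lemma measurableSet_cell {α : Finset Plane} (hα : α.Nonempty) (a : Plane) (j : Fin 6) :
    MeasurableSet (cell α a j) :=
  measurableSet_Icc.inter (measurable_assign_side hα j (measurableSet_singleton a))

lemma len_nonneg (α : Finset Plane) (a : Plane) (j : Fin 6) : 0 ≤ len α a j := measureReal_nonneg

lemma volume_ne_top_of_subset {E : Set ℝ} (hE : E ⊆ Set.Icc (0 : ℝ) 1) : volume E ≠ ⊤ :=
  measure_ne_top_of_subset hE (by simp)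

lemma norm_side_sub_sq_expand (j : Fin 6) (t m : ℝ) (p : Plane) :
    ‖side j t - p‖ ^ 2
      = (t - m) ^ 2 + 2 * inner ℝ (dir j) (side j m - p) * (t - m) + ‖side j m - p‖ ^ 2 := by
  have : side j t - p = (t - m) • dir j + (side j m - p) := by
    rw [side_eq, side_eq]; module
  rw [this, norm_add_sq_real, norm_smul, norm_dir, inner_smul_left, mul_one, Real.norm_eq_abs,
    sq_abs, conj_trivial]
  ring

/-- Parallel axis theorem: the cross term integrates to zero about the mean. Only the last summand
depends on `p`. -/
lemma setIntegral_norm_side_sub_sq {E : Set ℝ} (hE : E ⊆ Set.Icc (0 : ℝ) 1) (j : Fin 6)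
    (p : Plane) :
    ∫ t in E, ‖side j t - p‖ ^ 2
      = (∫ t in E, (t - ⨍ t in E, t) ^ 2) + volume.real E * ‖side j (⨍ t in E, t) - p‖ ^ 2 := by
  have hfin := volume_ne_top_of_subset hE
  set m := ⨍ t in E, t with hm
  have hid : IntegrableOn (fun t : ℝ => t) E :=
    (continuous_id.integrableOn_Icc (a := (0 : ℝ)) (b := 1)).mono_set hE
  have hsq : IntegrableOn (fun t : ℝ => (t - m) ^ 2) E :=
    ((by fun_prop : Continuous fun t : ℝ => (t - m) ^ 2).integrableOn_Icc
      (a := (0 : ℝ)) (b := 1)).mono_set hE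
  have hc : ∀ c : ℝ, IntegrableOn (fun _ : ℝ => c) E := fun c => integrableOn_const hfin
  have h0 : ∫ t in E, (t - m) = 0 := by
    have : IsFiniteMeasure (volume.restrict E) := isFiniteMeasure_restrict.2 hfin
    exact integral_sub_average (volume.restrict E) fun t => t
  rw [show (fun t => ‖side j t - p‖ ^ 2) = _ from funext fun t => norm_side_sub_sq_expand j t m p]
  have hlin : IntegrableOn (fun t : ℝ => 2 * inner ℝ (dir j) (side j m - p) * (t - m)) E :=
    (hid.sub (hc m)).const_mul _
  have hq : IntegrableOn (fun t : ℝ => (t - m) ^ 2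
    + 2 * inner ℝ (dir j) (side j m - p) * (t - m)) E := hsq.add hlin
  rw [integral_add hq (hc _), integral_add hsq hlin, integral_const_mul, h0, setIntegral_const,
    smul_eq_mul]
  ring

lemma volume_cell_ne_zero {α : Finset Plane} {a : Plane} {j : Fin 6} (h : 0 < len α a j) :
    volume (cell α a j) ≠ 0 := by
  intro h0; rw [len, Measure.real, h0] at h; simp at h

lemma integrableOn_of_subset_Icc {E : Set ℝ} (hE : E ⊆ Set.Icc (0 : ℝ) 1) {f : ℝ → ℝ}
    (hf : Continuous f) : IntegrableOn f E :=
  (hf.integrableOn_Icc (a := (0 : ℝ)) (b := 1)).mono_set hE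

lemma mid_pos {α : Finset Plane} {a : Plane} {j : Fin 6} (h : 0 < len α a j) :
    0 < mid α a j := by
  by_contra! hle
  have h1 := measure_le_setAverage_pos (volume_cell_ne_zero h)
    (volume_ne_top_of_subset (cell_subset α a j))
    (integrableOn_of_subset_Icc (cell_subset α a j) continuous_id)
  refine h1.ne' (measure_mono_null (t := {0}) ?_ (by simp))
  rintro t ⟨ht, ht2⟩
  exact le_antisymm (ht2.trans hle) (cell_subset α a j ht).1

lemma mid_lt_one {α : Finset Plane} {a : Plane} {j : Fin 6} (h : 0 < len α a j) :
    mid α a j < 1 := by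
  by_contra! hle
  have h1 := measure_setAverage_le_pos (volume_cell_ne_zero h)
    (volume_ne_top_of_subset (cell_subset α a j))
    (integrableOn_of_subset_Icc (cell_subset α a j) continuous_id)
  refine h1.ne' (measure_mono_null (t := {1}) ?_ (by simp))
  rintro t ⟨ht, ht2⟩
  exact le_antisymm (cell_subset α a j ht).2 (hle.trans ht2)

lemma mid_mem_Icc {α : Finset Plane} {a : Plane} {j : Fin 6} (h : 0 < len α a j) :
    mid α a j ∈ Set.Icc (0 : ℝ) 1 := ⟨(mid_pos h).le, (mid_lt_one h).le⟩

/-- Modifying the nearest point map of an optimal set on a part of the boundary cannot decrease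
the cost of that part. -/
lemma sum_setIntegral_le {n : ℕ} {α : Finset Plane} (hα : α.Nonempty)
    (h : IsOptimalMeans uniformDist n α) {β : Finset Plane} (hcard : β.card ≤ n)
    {g : Fin 6 → ℝ → Plane} (hg : ∀ j, Measurable (g j))
    (hβ : ∀ j, ∀ t ∈ Set.Icc (0 : ℝ) 1, g j t ∈ β) {E : Fin 6 → Set ℝ}
    (hE : ∀ j, MeasurableSet (E j)) (hsub : ∀ j, E j ⊆ Set.Icc (0 : ℝ) 1)
    (heq : ∀ j, ∀ t ∈ Set.Icc (0 : ℝ) 1 \ E j, g j t = assign α (side j t)) :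
    ∑ j, ∫ t in E j, ‖side j t - assign α (side j t)‖ ^ 2
      ≤ ∑ j, ∫ t in E j, ‖side j t - g j t‖ ^ 2 := by
  have h1 := sum_sideCost_le hα h hcard hg hβ
  rw [← sub_nonneg, ← Finset.sum_sub_distrib] at h1 ⊢
  refine h1.trans_eq (Finset.sum_congr rfl fun j _ => ?_)
  have i1 := integrableOn_cost j (hg j) (hβ j)
  have i2 := integrableOn_cost j (measurable_assign_side hα j) (β := α)
    fun t _ => assign_mem hα _
  have e1 := setIntegral_sdiff (hE j) i1 (hsub j)
  have e2 := setIntegral_sdiff (hE j) i2 (hsub j)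
  have e3 : ∫ t in Set.Icc (0 : ℝ) 1 \ E j, ‖side j t - g j t‖ ^ 2
      = ∫ t in Set.Icc (0 : ℝ) 1 \ E j, ‖side j t - assign α (side j t)‖ ^ 2 :=
    setIntegral_congr_fun (measurableSet_Icc.diff (hE j)) fun t ht => by
      simp only [heq j t ht]
  simp only [sideCost]
  linarith

/-- Replacing the point `b` of an optimal set by `b'`, and sending the part of the `j`th side
served by `b` to the point `p j`, cannot decrease the cost. -/
lemma sum_len_mul_le {n : ℕ} {α : Finset Plane}
    (h : IsOptimalMeans uniformDist n α) {b : Plane} (hb : b ∈ α) {b' : Plane}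
    {p : Fin 6 → Plane} (hp : ∀ j, p j = b' ∨ p j ∈ α ∧ p j ≠ b) :
    ∑ j, len α b j * ‖side j (mid α b j) - b‖ ^ 2
      ≤ ∑ j, len α b j * ‖side j (mid α b j) - p j‖ ^ 2 := by
  classical
  have hα : α.Nonempty := ⟨b, hb⟩
  have hcard : (insert b' (α.erase b)).card ≤ n := by
    have := Finset.card_insert_le b' (α.erase b)
    rw [Finset.card_erase_of_mem hb, Nat.sub_add_cancel (Finset.card_pos.2 hα)] at this
    exact this.trans h.1
  have hmeas : ∀ j, MeasurableSet {t : ℝ | assign α (side j t) = b} := fun j =>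
    measurable_assign_side hα j (measurableSet_singleton b)
  have key := sum_setIntegral_le hα h hcard
    (g := fun j t => if assign α (side j t) = b then p j else assign α (side j t))
    (fun j => Measurable.ite (hmeas j) measurable_const (measurable_assign_side hα j))
    (fun j t _ => by
      split_ifs with hb'
      · rcases hp j with hp | ⟨hp, hp'⟩
        · simp [hp]
        · simp [hp, hp']
      · simp [hb', assign_mem hα])
    (E := fun j => cell α b j) (fun j => measurableSet_cell hα b j) (fun j => cell_subset α b j)
    (fun j t ht => if_neg fun h' => ht.2 ⟨ht.1, h'⟩)
  have e1 : ∀ j, ∫ t in cell α b j, ‖side j t - assign α (side j t)‖ ^ 2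
      = ∫ t in cell α b j, ‖side j t - b‖ ^ 2 := fun j =>
    setIntegral_congr_fun (measurableSet_cell hα b j) fun t ht => by
      rw [ht.2]
  have e2 : ∀ j, ∫ t in cell α b j, ‖side j t -
        (if assign α (side j t) = b then p j else assign α (side j t))‖ ^ 2
      = ∫ t in cell α b j, ‖side j t - p j‖ ^ 2 := fun j =>
    setIntegral_congr_fun (measurableSet_cell hα b j) fun t ht => by
      rw [if_pos ht.2]
  -- The variance of each cell occurs on both sides and cancels.
  simp only [e1, e2, setIntegral_norm_side_sub_sq (cell_subset α b _)] at key
  rw [Finset.sum_add_distrib, Finset.sum_add_distrib] at key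
  exact le_of_add_le_add_left key

/-- On average, the points served by `b` are at least as close to `b` as to any other point. -/
lemma norm_side_mid_sub_le {α : Finset Plane} {b d : Plane} (hb : b ∈ α) (hd : d ∈ α)
    {j : Fin 6} (hj : 0 < len α b j) :
    ‖side j (mid α b j) - b‖ ≤ ‖side j (mid α b j) - d‖ := by
  have hα : α.Nonempty := ⟨b, hb⟩
  have hsub := cell_subset α b j
  have hc := continuous_side j
  have h1 : ∫ t in cell α b j, ‖side j t - b‖ ^ 2 ≤ ∫ t in cell α b j, ‖side j t - d‖ ^ 2 := by
    refine setIntegral_mono_on (integrableOn_of_subset_Icc hsub (by fun_prop))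
      (integrableOn_of_subset_Icc hsub (by fun_prop)) (measurableSet_cell hα b j) fun t ht => ?_
    have := norm_sub_assign_le (side j t) hd
    rw [ht.2] at this
    gcongr
  rw [setIntegral_norm_side_sub_sq hsub, setIntegral_norm_side_sub_sq hsub] at h1
  exact le_of_sq_le_sq (le_of_mul_le_mul_left (le_of_add_le_add_left h1) hj) (norm_nonneg _)

/-- Every point of an optimal set serves a part of the boundary of positive length. -/
lemma exists_len_pos {n : ℕ} {α : Finset Plane} (h : IsOptimalMeans uniformDist n α) {a : Plane}
    (ha : a ∈ α) : ∃ j, 0 < len α a j := by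
  classical
  by_contra! hlen
  have hα : α.Nonempty := ⟨a, ha⟩
  have hnull : ∀ j, volume (cell α a j) = 0 := fun j => by
    have h0 : len α a j = 0 := le_antisymm (hlen j) (len_nonneg _ _ _)
    exact (measureReal_eq_zero_iff (volume_ne_top_of_subset (cell_subset α a j))).1 h0
  -- An idle point `a` can be moved for free to a boundary point `x` outside `α`.
  obtain ⟨s, hs, hsα⟩ : ∃ s ∈ Set.Ioo (0 : ℝ) 1, side 0 s ∉ α := by
    by_contra! hcon
    have hinf : (side 0 '' Set.Ioo (0 : ℝ) 1).Infinite :=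
      (Set.Ioo_infinite one_pos).image (side_injective 0).injOn
    refine hinf (α.finite_toSet.subset ?_)
    rintro _ ⟨s, hs, rfl⟩
    exact hcon s hs
  set x := side 0 s
  obtain ⟨c, hc, hmin⟩ := α.exists_min_image (fun b => ‖x - b‖) hα
  set r := ‖x - c‖ with hr
  have hr0 : 0 < r := norm_pos_iff.2 (sub_ne_zero.2 fun e => hsα (e ▸ hc))
  -- On `U` the distance to `x` is at most `r / 3`, while every point of `α` is at distance at least
  -- `2 * r / 3`.
  set U : Set ℝ := Set.Icc 0 1 ∩ Set.Icc (s - r / 3) (s + r / 3) with hU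
  have hUm : MeasurableSet U := measurableSet_Icc.inter measurableSet_Icc
  have hUsub : U ⊆ Set.Icc (0 : ℝ) 1 := Set.inter_subset_left
  have hUpos : 0 < volume.real U := by
    rw [hU, Set.Icc_inter_Icc, Real.volume_real_Icc]
    refine lt_max_of_lt_left (sub_pos.2 ?_)
    simp only [sup_lt_iff, lt_inf_iff]
    refine ⟨⟨?_, ?_⟩, ?_, ?_⟩ <;> linarith [hs.1, hs.2]
  have hUE : ∀ j, MeasurableSet (if j = 0 then U ∪ cell α a j else cell α a j) := fun j => by
    split_ifs
    exacts [hUm.union (measurableSet_cell hα a j), measurableSet_cell hα a j]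
  have hcard : (insert x (α.erase a)).card ≤ n := by
    have := Finset.card_insert_le x (α.erase a)
    rw [Finset.card_erase_of_mem ha, Nat.sub_add_cancel (Finset.card_pos.2 hα)] at this
    exact this.trans h.1
  have hmeas : ∀ j, MeasurableSet {t : ℝ | assign α (side j t) = a} := fun j =>
    measurable_assign_side hα j (measurableSet_singleton a)
  have key := sum_setIntegral_le hα h hcard
    (g := fun j t => if (j = 0 ∧ t ∈ U) ∨ assign α (side j t) = a then x
      else assign α (side j t))
    (fun j => Measurable.ite (((MeasurableSet.const _).inter hUm).union (hmeas j))
      measurable_const (measurable_assign_side hα j))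
    (fun j t _ => by
      split_ifs with hb'
      · simp
      · simp [not_or.1 hb', assign_mem hα])
    (E := fun j => if j = 0 then U ∪ cell α a j else cell α a j) hUE
    (fun j => by
      split_ifs
      exacts [Set.union_subset hUsub (cell_subset _ _ _), cell_subset _ _ _])
    (fun j t ht => if_neg fun h' => ht.2 (by
      rcases h' with ⟨rfl, h'⟩ | h'
      · simp [h']
      · have : t ∈ cell α a j := ⟨ht.1, h'⟩
        split_ifs
        exacts [Or.inr this, this]))
  have hsum : ∀ F : Fin 6 → ℝ → ℝ,
      ∑ j, ∫ t in (if j = 0 then U ∪ cell α a j else cell α a j), F j t = ∫ t in U, F 0 t := by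
    intro F
    rw [Finset.sum_eq_single 0]
    · rw [if_pos rfl]
      exact setIntegral_congr_set (union_ae_eq_left_of_ae_eq_empty (ae_eq_empty.2 (hnull 0)))
    · intro j _ hj
      rw [if_neg hj]
      exact setIntegral_measure_zero _ (hnull j)
    · simp
  rw [hsum (fun j t => ‖side j t - assign α (side j t)‖ ^ 2), hsum (fun j t => ‖side j t -
    (if (j = 0 ∧ t ∈ U) ∨ assign α (side j t) = a then x else assign α (side j t))‖ ^ 2)] at key
  have hdist : ∀ t ∈ U, ‖side 0 t - x‖ ≤ r / 3 := fun t ht => by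
    rw [norm_side_sub_side, abs_le]
    constructor <;> linarith [ht.2.1, ht.2.2]
  have hfin := volume_ne_top_of_subset hUsub
  have up : ∫ t in U, ‖side 0 t -
      (if ((0 : Fin 6) = 0 ∧ t ∈ U) ∨ assign α (side 0 t) = a then x
        else assign α (side 0 t))‖ ^ 2 ≤ volume.real U * (r / 3) ^ 2 := by
    rw [← smul_eq_mul, ← setIntegral_const]
    have hcs := continuous_side 0
    rw [setIntegral_congr_fun hUm (g := fun t => ‖side 0 t - x‖ ^ 2)
      fun t ht => by dsimp only; rw [if_pos (Or.inl ⟨rfl, ht⟩)]]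
    refine setIntegral_mono_on (integrableOn_of_subset_Icc hUsub (by fun_prop))
      (integrableOn_const hfin) hUm fun t ht => ?_
    have := hdist t ht
    gcongr
  have low : volume.real U * (2 * r / 3) ^ 2
      ≤ ∫ t in U, ‖side 0 t - assign α (side 0 t)‖ ^ 2 := by
    rw [← smul_eq_mul, ← setIntegral_const]
    refine setIntegral_mono_on (integrableOn_const hfin)
      ((integrableOn_cost 0 (measurable_assign_side hα 0) (β := α)
        fun t _ => assign_mem hα _).mono_set hUsub) hUm fun t ht => ?_
    have h1 := hdist t ht
    have h2 := hmin _ (assign_mem hα (side 0 t))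
    have h3 : ‖x - assign α (side 0 t)‖ ≤ ‖side 0 t - x‖ + ‖side 0 t - assign α (side 0 t)‖ := by
      rw [norm_sub_rev _ x]
      exact norm_sub_le_norm_sub_add_norm_sub _ _ _
    have h4 : 2 * r / 3 ≤ ‖side 0 t - assign α (side 0 t)‖ := by linarith
    gcongr
  have := low.trans (key.trans up)
  nlinarith [mul_pos hUpos (pow_pos hr0 2)]

/-- The points of the boundary are uniformly close to every optimal set of `n`-means, for large
`n`. -/
lemma exists_forall_norm_sub_assign_lt {δ : ℝ} (hδ : 0 < δ) : ∃ N : ℕ, 1 ≤ N ∧ ∀ n, N ≤ n →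
    ∀ α, IsOptimalMeans uniformDist n α → ∀ j, ∀ t ∈ Set.Icc (0 : ℝ) 1,
      ‖side j t - assign α (side j t)‖ < δ := by
  classical
  wlog hδ1 : δ ≤ 1 generalizing δ
  · obtain ⟨N, hN, h⟩ := this one_pos le_rfl
    exact ⟨N, hN, fun n hn α hα j t ht => (h n hn α hα j t ht).trans (not_le.1 hδ1)⟩
  -- A net of mesh `δ ^ 2 / 8` has total cost at most `3 * δ ^ 4 / 32`. A boundary point at distance
  -- `δ` from `α` forces a cost of `δ ^ 3 / 8` on an interval of length `δ / 2`, which is too much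
  -- as `δ ≤ 1`.
  obtain ⟨T, hT, hcov⟩ := Metric.totallyBounded_iff.1
    (isCompact_Icc (a := (0 : ℝ)) (b := 1)).totallyBounded (δ ^ 2 / 8) (by positivity)
  set β : Finset Plane := Finset.univ.biUnion fun j => hT.toFinset.image (side j)
  refine ⟨max 1 β.card, le_max_left _ _, fun n hn α hopt j s hs => ?_⟩
  have hα := nonempty_of_isOptimalMeans ((le_max_left _ _).trans hn) hopt
  have hnet : ∀ j, ∀ t ∈ Set.Icc (0 : ℝ) 1, ∃ b ∈ β, ‖side j t - b‖ ≤ δ ^ 2 / 8 := by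
    intro j t ht
    obtain ⟨u, hu, htu⟩ := Set.mem_iUnion₂.1 (hcov ht)
    refine ⟨side j u, ?_, ?_⟩
    · simp only [β, Finset.mem_biUnion, Finset.mem_univ, true_and, Finset.mem_image]
      exact ⟨j, u, by simpa using hu, rfl⟩
    · rw [norm_side_sub_side]
      exact (Metric.mem_ball.1 htu).le
  have hβ : β.Nonempty := by
    obtain ⟨b, hb, -⟩ := hnet 0 0 (by simp)
    exact ⟨b, hb⟩
  have h1 := sum_sideCost_le hα hopt ((le_max_right _ _).trans hn)
    (g := fun j t => assign β (side j t)) (measurable_assign_side hβ)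
    (fun _ _ _ => assign_mem hβ _)
  have h2 : ∀ j, sideCost j (fun t => assign β (side j t)) ≤ (δ ^ 2 / 8) ^ 2 := fun j => by
    have : ∫ _ in Set.Icc (0 : ℝ) 1, (δ ^ 2 / 8) ^ 2 = (δ ^ 2 / 8) ^ 2 := by simp
    rw [← this]
    refine setIntegral_mono_on (integrableOn_cost j (measurable_assign_side hβ j) (β := β)
      fun _ _ => assign_mem hβ _) (integrableOn_const (by simp)) measurableSet_Icc fun t ht => ?_
    obtain ⟨b, hb, hbt⟩ := hnet j t ht
    have := (norm_sub_assign_le (side j t) hb).trans hbt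
    gcongr
  have h3 : ∑ j, sideCost j (fun t => assign β (side j t)) ≤ 6 * (δ ^ 2 / 8) ^ 2 := by
    refine (Finset.sum_le_sum fun j _ => h2 j).trans_eq ?_
    simp
  have h4 : sideCost j (fun t => assign α (side j t))
      ≤ ∑ j, sideCost j (fun t => assign α (side j t)) :=
    Finset.single_le_sum (f := fun j => sideCost j fun t => assign α (side j t))
      (fun j _ => sideCost_nonneg j _) (Finset.mem_univ j)
  by_contra! hfar
  have hfar' : ∀ a ∈ α, δ ≤ ‖side j s - a‖ := fun a ha =>
    hfar.trans (norm_sub_assign_le _ ha)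
  obtain ⟨u, hu0, hu1, hus, hsu⟩ : ∃ u, 0 ≤ u ∧ u + δ / 2 ≤ 1 ∧ s ≤ u + δ / 2 ∧ u ≤ s := by
    rcases le_total s (1 / 2) with h | h
    · exact ⟨s, hs.1, by linarith, by linarith, le_rfl⟩
    · exact ⟨s - δ / 2, by linarith, by linarith [hs.2], by linarith, by linarith⟩
  have hsub : Set.Icc u (u + δ / 2) ⊆ Set.Icc (0 : ℝ) 1 := Set.Icc_subset_Icc hu0 hu1
  have hint := integrableOn_cost j (measurable_assign_side hα j) (β := α)
    fun t _ => assign_mem hα _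
  have h5 : δ / 2 * (δ / 2) ^ 2 ≤ sideCost j (fun t => assign α (side j t)) := by
    have e : ∫ _ in Set.Icc u (u + δ / 2), (δ / 2) ^ 2 = δ / 2 * (δ / 2) ^ 2 := by
      rw [setIntegral_const, Real.volume_real_Icc_of_le (by linarith)]
      simp
    rw [← e]
    refine (setIntegral_mono_on (integrableOn_const (by simp)) (hint.mono_set hsub)
      measurableSet_Icc fun t ht => ?_).trans
      (setIntegral_mono_set hint (Eventually.of_forall fun _ => by positivity)
        (Eventually.of_forall hsub))
    have h6 := hfar' _ (assign_mem hα (side j t))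
    have h7 : ‖side j t - side j s‖ ≤ δ / 2 := by
      rw [norm_side_sub_side, abs_le]
      constructor <;> linarith [ht.1, ht.2]
    have h8 := norm_sub_le_norm_sub_add_norm_sub (side j s) (side j t) (assign α (side j t))
    rw [norm_sub_rev (side j s) (side j t)] at h8
    have h9 : δ / 2 ≤ ‖side j t - assign α (side j t)‖ := by linarith
    gcongr
  have h10 : δ / 2 * (δ / 2) ^ 2 ≤ 6 * (δ ^ 2 / 8) ^ 2 := h5.trans (h4.trans (h1.trans h3))
  have h11 : δ ^ 3 * δ ≤ δ ^ 3 * 1 := by gcongr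
  nlinarith [pow_pos hδ 3]

/-! ### Pure and mixed points -/

/-- An optimal set of `n`-means whose points come within `δ` of every point of the boundary. -/
structure IsFineOptimal (n : ℕ) (δ : ℝ) (α : Finset Plane) : Prop where
  opt : IsOptimalMeans uniformDist n α
  nonempty : α.Nonempty
  norm_sub_assign_lt : ∀ j, ∀ t ∈ Set.Icc (0 : ℝ) 1, ‖side j t - assign α (side j t)‖ < δ

/-- The point `a ∈ α` serves parts of positive length of both sides `i` and `i + 1`. -/
def Mixed (α : Finset Plane) (a : Plane) (i : Fin 6) : Prop :=
  0 < len α a i ∧ 0 < len α a (i + 1)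

variable {n : ℕ} {δ : ℝ} {α : Finset Plane}

lemma exists_isFineOptimal {δ : ℝ} (hδ : 0 < δ) : ∃ N : ℕ, ∀ n, N ≤ n →
    ∀ α, IsOptimalMeans uniformDist n α → IsFineOptimal n δ α := by
  obtain ⟨N, hN, h⟩ := exists_forall_norm_sub_assign_lt hδ
  exact ⟨N, fun n hn α hα => ⟨hα, nonempty_of_isOptimalMeans (hN.trans hn) hα, h n hn α hα⟩⟩

lemma IsFineOptimal.norm_side_mid_sub_lt (h : IsFineOptimal n δ α) {a : Plane} (ha : a ∈ α)
    {j : Fin 6} (hj : 0 < len α a j) : ‖side j (mid α a j) - a‖ < δ :=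
  (norm_side_mid_sub_le ha (assign_mem h.nonempty _) hj).trans_lt
    (h.norm_sub_assign_lt j _ (mid_mem_Icc hj))

lemma IsFineOptimal.not_farSides (h : IsFineOptimal n δ α) (hδ : δ ≤ 1 / 24) {a : Plane}
    (ha : a ∈ α) {i j : Fin 6} (hi : 0 < len α a i) (hj : 0 < len α a j) : ¬ FarSides i j := by
  intro hf
  have h1 := one_le_dist_of_farSides hf (mid_mem_Icc hi) (mid_mem_Icc hj)
  have h2 := h.norm_side_mid_sub_lt ha hi
  have h3 := h.norm_side_mid_sub_lt ha hj
  rw [dist_eq_norm] at h1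
  have h4 := norm_sub_le_norm_sub_add_norm_sub (side i (mid α a i)) a (side j (mid α a j))
  rw [norm_sub_rev a] at h4
  linarith

lemma eq_singleton_or_pair_of_not_farSides : ∀ C : Finset (Fin 6), C.Nonempty →
    (∀ i ∈ C, ∀ j ∈ C, ¬ FarSides i j) → (∃ j, C = {j}) ∨ ∃ i, C = {i, i + 1} := by
  decide

lemma ne_add_one (i : Fin 6) : i ≠ i + 1 := by decide +revert

lemma IsFineOptimal.pure_or_mixed (h : IsFineOptimal n δ α) (hδ : δ ≤ 1 / 24) {a : Plane}
    (ha : a ∈ α) : (∃ j, 0 < len α a j ∧ ∀ k, k ≠ j → len α a k = 0) ∨ ∃ i, Mixed α a i := by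
  classical
  obtain ⟨j, hj⟩ := exists_len_pos h.opt ha
  have hmem : ∀ k, k ∈ Finset.univ.filter (fun k => 0 < len α a k) ↔ 0 < len α a k := by simp
  rcases eq_singleton_or_pair_of_not_farSides (Finset.univ.filter fun k => 0 < len α a k)
    ⟨j, (hmem j).2 hj⟩
    (fun i hi j hj => h.not_farSides hδ ha ((hmem i).1 hi) ((hmem j).1 hj)) with ⟨i, hi⟩ | ⟨i, hi⟩
  · refine Or.inl ⟨i, (hmem i).1 (by simp [hi]), fun k hk => ?_⟩
    refine le_antisymm (not_lt.1 fun hlt => ?_) (len_nonneg _ _ _)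
    have := (hmem k).2 hlt
    rw [hi] at this
    exact hk (Finset.mem_singleton.1 this)
  · exact Or.inr ⟨i, (hmem i).1 (by simp [hi]), (hmem (i + 1)).1 (by simp [hi])⟩

lemma exists_farSides_of_ne : ∀ i k : Fin 6, k ≠ i → k ≠ i + 1 →
    FarSides i k ∨ FarSides (i + 1) k := by decide

lemma IsFineOptimal.len_eq_zero_of_mixed (h : IsFineOptimal n δ α) (hδ : δ ≤ 1 / 24) {a : Plane}
    (ha : a ∈ α) {i : Fin 6} (hi : Mixed α a i) {k : Fin 6} (hk : k ≠ i) (hk' : k ≠ i + 1) :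
    len α a k = 0 := by
  refine le_antisymm (not_lt.1 fun hlt => ?_) (len_nonneg _ _ _)
  rcases exists_farSides_of_ne i k hk hk' with hf | hf
  · exact h.not_farSides hδ ha hi.1 hlt hf
  · exact h.not_farSides hδ ha hi.2 hlt hf

lemma IsFineOptimal.eq_side_of_pure (h : IsFineOptimal n δ α) {a : Plane} (ha : a ∈ α) {j : Fin 6}
    (hj : 0 < len α a j) (hk : ∀ k, k ≠ j → len α a k = 0) : a = side j (mid α a j) := by
  have key := sum_len_mul_le h.opt ha (b' := side j (mid α a j))
    (p := fun _ => side j (mid α a j)) (fun _ => Or.inl rfl)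
  rw [Finset.sum_eq_single j (fun k _ hkj => by simp [hk k hkj]) (by simp),
    Finset.sum_eq_single j (fun k _ hkj => by simp [hk k hkj]) (by simp)] at key
  simp only [sub_self, norm_zero, ne_eq, OfNat.ofNat_ne_zero, not_false_eq_true, zero_pow,
    mul_zero] at key
  have h1 : ‖side j (mid α a j) - a‖ ^ 2 ≤ 0 := by
    by_contra! hc
    exact absurd key (not_le.2 (mul_pos hj hc))
  have h2 : ‖side j (mid α a j) - a‖ = 0 := by
    simpa using le_antisymm h1 (by positivity)
  exact (sub_eq_zero.1 (norm_eq_zero.1 h2)).symm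

lemma IsFineOptimal.mixed_le (h : IsFineOptimal n δ α) (hδ : δ ≤ 1 / 24) {a : Plane}
    (ha : a ∈ α) {i : Fin 6} (hi : Mixed α a i) {b' : Plane} {p : Fin 6 → Plane}
    (hp : ∀ j, p j = b' ∨ p j ∈ α ∧ p j ≠ a) :
    len α a i * ‖cornerPt i (1 - mid α a i) 0 - a‖ ^ 2
        + len α a (i + 1) * ‖cornerPt i 0 (mid α a (i + 1)) - a‖ ^ 2
      ≤ len α a i * ‖cornerPt i (1 - mid α a i) 0 - p i‖ ^ 2
        + len α a (i + 1) * ‖cornerPt i 0 (mid α a (i + 1)) - p (i + 1)‖ ^ 2 := by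
  have key := sum_len_mul_le h.opt ha hp
  have hz : ∀ k, k ≠ i ∧ k ≠ i + 1 → len α a k = 0 := fun k hk =>
    h.len_eq_zero_of_mixed hδ ha hi hk.1 hk.2
  rw [Finset.sum_eq_add i (i + 1) (ne_add_one i) (fun k _ hk => by simp [hz k hk]) (by simp)
    (by simp), Finset.sum_eq_add i (i + 1) (ne_add_one i) (fun k _ hk => by simp [hz k hk])
    (by simp) (by simp)] at key
  simpa only [side_eq_cornerPt i, side_succ_eq_cornerPt] using key

lemma eq_zero_of_quadratic_le {x y : ℝ} (h : x ^ 2 + y ^ 2 - x * y ≤ 0) : x = 0 ∧ y = 0 := by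
  have hx : x ^ 2 ≤ 0 := by nlinarith [sq_nonneg (2 * y - x)]
  have hy : y ^ 2 ≤ 0 := by nlinarith [sq_nonneg (2 * x - y)]
  exact ⟨by simpa using le_antisymm hx (sq_nonneg x), by simpa using le_antisymm hy (sq_nonneg y)⟩

/-- A point that serves two adjacent sides is the centroid of what it serves. -/
lemma IsFineOptimal.mixed_eq (h : IsFineOptimal n δ α) (hδ : δ ≤ 1 / 24) {a : Plane}
    (ha : a ∈ α) {i : Fin 6} (hi : Mixed α a i) :
    a = cornerPt i (len α a i * (1 - mid α a i) / (len α a i + len α a (i + 1)))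
      (len α a (i + 1) * mid α a (i + 1) / (len α a i + len α a (i + 1))) := by
  obtain ⟨x, y, hxy⟩ : ∃ x y, a = cornerPt i x y := ⟨_, _, exists_eq_cornerPt i a⟩
  have h1 := hi.1
  have h2 := hi.2
  have key := h.mixed_le hδ ha hi
    (b' := cornerPt i (len α a i * (1 - mid α a i) / (len α a i + len α a (i + 1)))
      (len α a (i + 1) * mid α a (i + 1) / (len α a i + len α a (i + 1))))
    (fun _ => Or.inl rfl)
  set w₁ := len α a i
  set w₂ := len α a (i + 1)
  set q₁ := 1 - mid α a i
  set q₂ := mid α a (i + 1)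
  set X := w₁ * q₁ / (w₁ + w₂) with hX
  set Y := w₂ * q₂ / (w₁ + w₂) with hY
  have hS : 0 < w₁ + w₂ := by positivity
  have hX' : X * (w₁ + w₂) = w₁ * q₁ := div_mul_cancel₀ _ hS.ne'
  have hY' : Y * (w₁ + w₂) = w₂ * q₂ := div_mul_cancel₀ _ hS.ne'
  rw [hxy] at key ⊢
  simp only [norm_cornerPt_sub_sq] at key
  -- The excess over the cost at the centroid is the total mass times the squared distance to the
  -- centroid.
  have : (w₁ + w₂) * ((x - X) ^ 2 + (y - Y) ^ 2 - (x - X) * (y - Y)) ≤ (w₁ + w₂) * 0 := by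
    linear_combination key + (2 * X - 2 * x - Y + y) * hX' + (2 * Y - 2 * y - X + x) * hY'
  obtain ⟨e1, e2⟩ := eq_zero_of_quadratic_le (le_of_mul_le_mul_left this hS)
  rw [sub_eq_zero.1 e1, sub_eq_zero.1 e2]

/-- Coordinates of a point that serves both sides at a vertex. -/
lemma IsFineOptimal.exists_mixed_coords (h : IsFineOptimal n δ α) (hδ : δ ≤ 1 / 24) {a : Plane}
    (ha : a ∈ α) {i : Fin 6} (hi : Mixed α a i) : ∃ x y, a = cornerPt i x y ∧ 0 < x ∧ 0 < y ∧
      x < 1 - mid α a i ∧ y < mid α a (i + 1) := by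
  refine ⟨_, _, h.mixed_eq hδ ha hi, ?_⟩
  obtain ⟨h1, h2⟩ := hi
  have h3 := mid_lt_one h1
  have h4 := mid_pos h2
  have h5 : 0 < 1 - mid α a i := by linarith
  refine ⟨by positivity, by positivity, ?_, ?_⟩ <;> rw [div_lt_iff₀ (by positivity)] <;>
    nlinarith [mul_pos h2 h5, mul_pos h1 h4]

/-! ### At most one mixed point at each vertex -/

/-- The common left side is `w₁ * w₂ * Q / (w₁ + w₂)`, with `Q` the squared distance of the two
means; `U` and `V` are the squared distances of `(x, y)` to them. The hypotheses add up to `Q ≤ U +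
V`, whereas inside the parallelogram the angle subtended is obtuse. The only escape, `(x, y)` equal
to one of the means, makes `U` or `V` vanish. -/
lemma false_of_obtuse {w₁ w₂ q₁ q₂ x y : ℝ} (h1 : 0 < w₁) (h2 : 0 < w₂) (hq₁ : 0 < q₁)
    (hq₂ : 0 < q₂) (hx : 0 ≤ x) (hxq : x ≤ q₁) (hy : 0 ≤ y) (hyq : y ≤ q₂)
    (k1 : w₁ * ((q₁ - w₁ * q₁ / (w₁ + w₂)) ^ 2 + (w₂ * q₂ / (w₁ + w₂)) ^ 2
        + (q₁ - w₁ * q₁ / (w₁ + w₂)) * (w₂ * q₂ / (w₁ + w₂)))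
      + w₂ * ((w₁ * q₁ / (w₁ + w₂)) ^ 2 + (q₂ - w₂ * q₂ / (w₁ + w₂)) ^ 2
        + (w₁ * q₁ / (w₁ + w₂)) * (q₂ - w₂ * q₂ / (w₁ + w₂)))
      ≤ w₁ * ((q₁ - x) ^ 2 + y ^ 2 + (q₁ - x) * y))
    (k2 : w₁ * ((q₁ - w₁ * q₁ / (w₁ + w₂)) ^ 2 + (w₂ * q₂ / (w₁ + w₂)) ^ 2
        + (q₁ - w₁ * q₁ / (w₁ + w₂)) * (w₂ * q₂ / (w₁ + w₂)))
      + w₂ * ((w₁ * q₁ / (w₁ + w₂)) ^ 2 + (q₂ - w₂ * q₂ / (w₁ + w₂)) ^ 2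
        + (w₁ * q₁ / (w₁ + w₂)) * (q₂ - w₂ * q₂ / (w₁ + w₂)))
      ≤ w₂ * (x ^ 2 + (q₂ - y) ^ 2 + x * (q₂ - y))) : False := by
  have hS : 0 < w₁ + w₂ := by positivity
  obtain ⟨Q, hQ⟩ : ∃ Q, Q = q₁ ^ 2 + q₂ ^ 2 + q₁ * q₂ := ⟨_, rfl⟩
  have hQ0 : 0 < Q := by rw [hQ]; positivity
  obtain ⟨U, hU⟩ : ∃ U, U = (q₁ - x) ^ 2 + y ^ 2 + (q₁ - x) * y := ⟨_, rfl⟩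
  obtain ⟨V, hV⟩ : ∃ V, V = x ^ 2 + (q₂ - y) ^ 2 + x * (q₂ - y) := ⟨_, rfl⟩
  have e : w₁ * ((q₁ - w₁ * q₁ / (w₁ + w₂)) ^ 2 + (w₂ * q₂ / (w₁ + w₂)) ^ 2
        + (q₁ - w₁ * q₁ / (w₁ + w₂)) * (w₂ * q₂ / (w₁ + w₂)))
      + w₂ * ((w₁ * q₁ / (w₁ + w₂)) ^ 2 + (q₂ - w₂ * q₂ / (w₁ + w₂)) ^ 2
        + (w₁ * q₁ / (w₁ + w₂)) * (q₂ - w₂ * q₂ / (w₁ + w₂)))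
      = w₁ * w₂ * Q / (w₁ + w₂) := by
    rw [hQ]; field_simp; ring
  rw [e, ← hU, div_le_iff₀ hS] at k1
  rw [e, ← hV, div_le_iff₀ hS] at k2
  have f1 : w₂ * Q ≤ (w₁ + w₂) * U := by
    refine le_of_mul_le_mul_left ?_ h1
    linear_combination k1
  have f2 : w₁ * Q ≤ (w₁ + w₂) * V := by
    refine le_of_mul_le_mul_left ?_ h2
    linear_combination k2
  have f3 : Q ≤ U + V := by
    refine le_of_mul_le_mul_left ?_ hS
    linear_combination f1 + f2
  have g1 := mul_nonneg (sub_nonneg.2 hxq) (sub_nonneg.2 hyq)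
  have g2 := mul_nonneg hx (sub_nonneg.2 hxq)
  have g3 := mul_nonneg hy (sub_nonneg.2 hyq)
  have g4 := mul_nonneg hx hy
  have hsum : (q₁ - x) * (q₂ - y) + 2 * (x * (q₁ - x)) + 2 * (y * (q₂ - y)) + x * y ≤ 0 := by
    rw [hQ, hU, hV] at f3; linear_combination f3
  have z1 : (q₁ - x) * (q₂ - y) = 0 := by linarith
  have z4 : x * y = 0 := by linarith
  rcases mul_eq_zero.1 z1 with z | z
  · have hxq : x = q₁ := by linarith
    have hy0 : y = 0 := (mul_eq_zero.1 z4).resolve_left (by rw [hxq]; exact hq₁.ne')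
    have hU0 : U = 0 := by rw [hU, hxq, hy0]; ring
    rw [hU0, mul_zero] at f1
    exact absurd f1 (not_le.2 (mul_pos h2 hQ0))
  · have hyq : y = q₂ := by linarith
    have hx0 : x = 0 := (mul_eq_zero.1 z4).resolve_right (by rw [hyq]; exact hq₂.ne')
    have hV0 : V = 0 := by rw [hV, hyq, hx0]; ring
    rw [hV0, mul_zero] at f2
    exact absurd f2 (not_le.2 (mul_pos h1 hQ0))

/-- If `b` serves both sides at a vertex then no other point of `α` lies in the parallelogram
spanned by the centroids of the two parts. -/
lemma IsFineOptimal.not_mem_parallelogram (h : IsFineOptimal n δ α) (hδ : δ ≤ 1 / 24)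
    {b d : Plane} (hb : b ∈ α) {i : Fin 6} (hi : Mixed α b i) (hd : d ∈ α) (hdb : d ≠ b)
    {x y : ℝ} (hxy : d = cornerPt i x y) (hx : 0 ≤ x) (hxq : x ≤ 1 - mid α b i) (hy : 0 ≤ y)
    (hyq : y ≤ mid α b (i + 1)) : False := by
  have hne := ne_add_one i
  -- Two competitors: `d` takes over one part of what `b` serves, and `b` moves to the mean of the
  -- other part.
  have k1 := h.mixed_le hδ hb hi (b' := cornerPt i 0 (mid α b (i + 1)))
    (p := fun j => if j = i then d else cornerPt i 0 (mid α b (i + 1)))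
    (fun j => by split_ifs; exacts [Or.inr ⟨hd, hdb⟩, Or.inl rfl])
  have k2 := h.mixed_le hδ hb hi (b' := cornerPt i (1 - mid α b i) 0)
    (p := fun j => if j = i then cornerPt i (1 - mid α b i) 0 else d)
    (fun j => by split_ifs; exacts [Or.inl rfl, Or.inr ⟨hd, hdb⟩])
  have hbe := h.mixed_eq hδ hb hi
  obtain ⟨h1, h2⟩ := hi
  simp only [if_true, if_neg hne.symm] at k1 k2
  have hq₁ : 0 < 1 - mid α b i := by linarith [mid_lt_one h1]
  have hq₂ := mid_pos h2
  generalize len α b i = w₁ at *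
  generalize len α b (i + 1) = w₂ at *
  generalize 1 - mid α b i = q₁ at *
  generalize mid α b (i + 1) = q₂ at *
  rw [hxy, hbe] at k1 k2
  simp only [norm_cornerPt_sub_sq] at k1 k2
  refine false_of_obtuse h1 h2 hq₁ hq₂ hx hxq hy hyq ?_ ?_
  · linear_combination k1
  · linear_combination k2

/-- At most one point of `α` serves both sides at a given vertex. -/
lemma IsFineOptimal.mixed_unique (h : IsFineOptimal n δ α) (hδ : δ ≤ 1 / 24) {b d : Plane}
    (hb : b ∈ α) (hd : d ∈ α) {i : Fin 6} (hbi : Mixed α b i) (hdi : Mixed α d i) : b = d := by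
  by_contra hbd
  wlog hle : mid α b i ≤ mid α d i generalizing b d
  · exact this hd hb hdi hbi (Ne.symm hbd) (not_le.1 hle).le
  obtain ⟨X, Y, hbe, hX, hY, hXq, hYq⟩ := h.exists_mixed_coords hδ hb hbi
  obtain ⟨X', Y', hde, hX', hY', hXq', hYq'⟩ := h.exists_mixed_coords hδ hd hdi
  rcases le_or_gt (mid α d (i + 1)) (mid α b (i + 1)) with hle2 | hlt2
  · exact h.not_mem_parallelogram hδ hb hbi hd (Ne.symm hbd) hde hX'.le (by linarith) hY'.le
      (by linarith)
  rcases hle.eq_or_lt with heq | hlt1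
  · exact h.not_mem_parallelogram hδ hd hdi hb hbd hbe hX.le (by linarith) hY.le (by linarith)
  have sq : ∀ {u v : ℝ}, 0 ≤ u → u ≤ v → u ^ 2 ≤ v ^ 2 := fun h1 h2 => by gcongr
  have a1 := sq (norm_nonneg _) (norm_side_mid_sub_le hb hd hbi.1)
  have a2 := sq (norm_nonneg _) (norm_side_mid_sub_le hb hd hbi.2)
  have a3 := sq (norm_nonneg _) (norm_side_mid_sub_le hd hb hdi.1)
  have a4 := sq (norm_nonneg _) (norm_side_mid_sub_le hd hb hdi.2)
  rw [side_eq_cornerPt] at a1 a3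
  rw [side_succ_eq_cornerPt] at a2 a4
  have hq₁ : 0 < 1 - mid α d i := by linarith
  have hq₂ := mid_pos hbi.2
  set q₁ := 1 - mid α b i
  set q₂ := mid α b (i + 1)
  set r₁ := 1 - mid α d i
  set r₂ := mid α d (i + 1)
  have hq : r₁ < q₁ := by simp only [q₁, r₁]; linarith
  rw [hbe, hde] at a1 a2 a3 a4
  simp only [norm_cornerPt_sub_sq] at a1 a2 a3 a4
  -- The squared distance to `d` minus that to `b` is affine: `c₀` is its value at the vertex, `c₁`
  -- and `c₂` its slopes along the two sides. Its signs at the four means give `c₀ ≤ 0` from one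
  -- side and `c₀ ≥ 0` from the other, so it vanishes identically.
  obtain ⟨c₁, hc₁⟩ : ∃ c, c = -2 * X' + Y' + 2 * X - Y := ⟨_, rfl⟩
  obtain ⟨c₂, hc₂⟩ : ∃ c, c = -2 * Y' + X' + 2 * Y - X := ⟨_, rfl⟩
  obtain ⟨c₀, hc₀⟩ : ∃ c, c = X' ^ 2 + Y' ^ 2 - X' * Y' - (X ^ 2 + Y ^ 2 - X * Y) := ⟨_, rfl⟩
  have b1 : 0 ≤ c₀ + c₁ * q₁ := by rw [hc₀, hc₁]; linear_combination a1
  have b2 : 0 ≤ c₀ + c₂ * q₂ := by rw [hc₀, hc₂]; linear_combination a2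
  have b3 : c₀ + c₁ * r₁ ≤ 0 := by rw [hc₀, hc₁]; linear_combination a3
  have b4 : c₀ + c₂ * r₂ ≤ 0 := by rw [hc₀, hc₂]; linear_combination a4
  have d1 : 0 ≤ c₁ := by
    by_contra! hc
    nlinarith [mul_pos_of_neg_of_neg hc (sub_neg.2 hq)]
  have d2 : c₂ ≤ 0 := by
    by_contra! hc
    nlinarith [mul_pos hc (sub_pos.2 hlt2)]
  have d0 : c₀ = 0 := by
    have := mul_nonneg d1 hq₁.le
    have := mul_nonneg (neg_nonneg.2 d2) hq₂.le
    linarith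
  have e1 : c₁ = 0 := by
    have := mul_nonneg d1 hq₁.le
    have : c₁ * r₁ = 0 := by linarith
    exact (mul_eq_zero.1 this).resolve_right hq₁.ne'
  have e2 : c₂ = 0 := by
    have := mul_nonneg (neg_nonneg.2 d2) hq₂.le
    have : c₂ * q₂ = 0 := by linarith
    exact (mul_eq_zero.1 this).resolve_right hq₂.ne'
  refine hbd ?_
  rw [hbe, hde, show X = X' by linarith, show Y = Y' by linarith]

/-- The two means of `b` are less than `2 * δ` apart, and the 120° angle makes their distance at
least that from `b` to the vertex. -/
lemma IsFineOptimal.norm_vertex_sub_lt (h : IsFineOptimal n δ α) (hδ : δ ≤ 1 / 24) {b : Plane}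
    (hb : b ∈ α) {i : Fin 6} (hi : Mixed α b i) : ‖vertex (i + 1) - b‖ < 2 * δ := by
  obtain ⟨X, Y, hbe, hX, hY, hXq, hYq⟩ := h.exists_mixed_coords hδ hb hi
  have h1 := h.norm_side_mid_sub_lt hb hi.1
  have h2 := h.norm_side_mid_sub_lt hb hi.2
  have h3 := norm_sub_le_norm_sub_add_norm_sub (side i (mid α b i)) b
    (side (i + 1) (mid α b (i + 1)))
  rw [norm_sub_rev b] at h3
  refine lt_of_le_of_lt (le_of_sq_le_sq ?_ (norm_nonneg _)) (h3.trans_lt (by linarith))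
  rw [side_eq_cornerPt, side_succ_eq_cornerPt, vertex_eq_cornerPt, norm_cornerPt_sub_sq]
  nth_rw 1 [hbe]
  rw [norm_cornerPt_sub_sq]
  nlinarith [mul_pos hX hY, mul_pos (hX.trans hXq) (hY.trans hYq)]

lemma IsFineOptimal.near_vertex (h : IsFineOptimal n δ α) (hδ : δ ≤ 1 / 24) {d : Plane}
    (hd : d ∈ α) {i : Fin 6} (hdi : ‖vertex (i + 1) - d‖ < 2 * δ) {k : Fin 6}
    (hk : 0 < len α d k) : k = i ∨ k = i + 1 := by
  by_contra! hne
  have h1 := h.norm_side_mid_sub_lt hd hk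
  have h2 := norm_sub_le_norm_sub_add_norm_sub (vertex (i + 1)) d (side k (mid α d k))
  rw [norm_sub_rev d] at h2
  have h3 : 1 ≤ ‖vertex (i + 1) - side k (mid α d k)‖ := by
    rcases exists_farSides_of_ne i k hne.1 hne.2 with hf | hf
    · have := one_le_dist_of_farSides hf (s := 1) (by simp) (mid_mem_Icc hk)
      rwa [dist_eq_norm, side_eq_cornerPt, sub_self, ← vertex_eq_cornerPt] at this
    · have := one_le_dist_of_farSides hf (s := 0) (by simp) (mid_mem_Icc hk)
      rwa [dist_eq_norm, side_succ_eq_cornerPt, ← vertex_eq_cornerPt] at this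
  linarith

/-- A point that serves both sides at a vertex is strictly closer to the vertex than any other
point of `α`. -/
lemma IsFineOptimal.norm_vertex_sub_lt_of_mixed (h : IsFineOptimal n δ α) (hδ : δ ≤ 1 / 24)
    {b d : Plane} (hb : b ∈ α) {i : Fin 6} (hi : Mixed α b i) (hd : d ∈ α) (hdb : d ≠ b) :
    ‖vertex (i + 1) - b‖ < ‖vertex (i + 1) - d‖ := by
  by_contra! hle
  have hnear := hle.trans_lt (h.norm_vertex_sub_lt hδ hb hi)
  have hch := fun k => h.near_vertex hδ hd hnear (k := k)
  obtain ⟨X, Y, hbe, hX, hY, hXq, hYq⟩ := h.exists_mixed_coords hδ hb hi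
  have hq₂ := mid_pos hi.2
  have sq : ∀ {u v : ℝ}, 0 ≤ u → u ≤ v → u ^ 2 ≤ v ^ 2 := fun h1 h2 => by gcongr
  have v0 := sq (norm_nonneg _) hle
  have v1 := sq (norm_nonneg _) (norm_side_mid_sub_le hb hd hi.1)
  have v2 := sq (norm_nonneg _) (norm_side_mid_sub_le hb hd hi.2)
  rw [side_eq_cornerPt] at v1
  rw [side_succ_eq_cornerPt] at v2
  rw [vertex_eq_cornerPt] at v0
  -- an affine function that is `≤ 0` at `0` and `≥ 0` at `q > 0` is `≥ 0` beyond `q`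
  have aff : ∀ {c₀ c₁ q x : ℝ}, c₀ ≤ 0 → 0 ≤ c₀ + c₁ * q → 0 < q → q < x → 0 ≤ c₀ + c₁ * x := by
    intro c₀ c₁ q x h0 h1 hq hx
    have hc : 0 ≤ c₁ := by
      by_contra! hc
      nlinarith [mul_pos (neg_pos.2 hc) hq]
    nlinarith [mul_nonneg hc (sub_pos.2 hx).le]
  obtain ⟨k, hk⟩ := exists_len_pos h.opt hd
  by_cases hi0 : 0 < len α d i
  · by_cases hi1 : 0 < len α d (i + 1)
    · exact hdb (h.mixed_unique hδ hd hb ⟨hi0, hi1⟩ hi)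
    · have hde := h.eq_side_of_pure hd hi0 fun k hki =>
        le_antisymm (not_lt.1 fun hk => by
          rcases hch k hk with rfl | rfl
          exacts [hki rfl, hi1 hk]) (len_nonneg _ _ _)
      rw [side_eq_cornerPt] at hde
      have hx0 : 0 ≤ 1 - mid α d i := by linarith [mid_lt_one hi0]
      set x := 1 - mid α d i
      rcases le_or_gt x (1 - mid α b i) with hx | hx
      · exact h.not_mem_parallelogram hδ hb hi hd hdb hde hx0 hx le_rfl hq₂.le
      set q := 1 - mid α b i
      rw [hde, hbe] at v0 v1
      simp only [norm_cornerPt_sub_sq] at v0 v1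
      -- The squared distance to `d` minus that to `b` is nonpositive at the vertex and nonnegative
      -- at the mean, hence nonnegative at `d` itself. This forces `d = b`, although `d` is on the
      -- side and `b` is not.
      have := aff (c₀ := x ^ 2 - (X ^ 2 + Y ^ 2 - X * Y)) (c₁ := -2 * x + 2 * X - Y)
        (q := q) (x := x) (by linear_combination v0) (by linear_combination v1)
        (hX.trans hXq) hx
      obtain ⟨e1, e2⟩ := eq_zero_of_quadratic_le (x := x - X) (y := 0 - Y)
        (by linear_combination this)
      linarith
  · have hi1 : 0 < len α d (i + 1) := by
      rcases hch k hk with rfl | rfl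
      exacts [absurd hk hi0, hk]
    have hde := h.eq_side_of_pure hd hi1 fun k hki =>
      le_antisymm (not_lt.1 fun hk => by
        rcases hch k hk with rfl | rfl
        exacts [hi0 hk, hki rfl]) (len_nonneg _ _ _)
    rw [side_succ_eq_cornerPt] at hde
    have hx0 : 0 ≤ mid α d (i + 1) := (mid_pos hi1).le
    set x := mid α d (i + 1)
    rcases le_or_gt x (mid α b (i + 1)) with hx | hx
    · exact h.not_mem_parallelogram hδ hb hi hd hdb hde le_rfl (hX.trans hXq).le hx0 hx
    set q := mid α b (i + 1)
    rw [hde, hbe] at v0 v2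
    simp only [norm_cornerPt_sub_sq] at v0 v2
    have := aff (c₀ := x ^ 2 - (X ^ 2 + Y ^ 2 - X * Y)) (c₁ := -2 * x + 2 * Y - X)
      (q := q) (x := x) (by linear_combination v0) (by linear_combination v2)
      hq₂ hx
    obtain ⟨e1, e2⟩ := eq_zero_of_quadratic_le (x := 0 - X) (y := x - Y)
      (by linear_combination this)
    linarith

/-! ### Block replacement and the cost of intervals -/

/-- Replacing the points of `M ⊆ α` by the points of `S`, and the nearest point map by `g` on a
set that contains almost everything that is served by `M`, cannot decrease the cost. -/
lemma sum_setIntegral_le_of_replace {n : ℕ} {α : Finset Plane} (hα : α.Nonempty)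
    (h : IsOptimalMeans uniformDist n α) {M S : Finset Plane} (hM : M ⊆ α) (hS : S.Nonempty)
    (hcard : S.card ≤ M.card) {I : Fin 6 → Set ℝ} (hI : ∀ j, MeasurableSet (I j))
    (hsub : ∀ j, I j ⊆ Set.Icc (0 : ℝ) 1) {g : Fin 6 → ℝ → Plane} (hg : ∀ j, Measurable (g j))
    (hgS : ∀ j, ∀ t ∈ I j, g j t ∈ S)
    (hnull : ∀ j, ∀ t ∈ Set.Icc (0 : ℝ) 1 \ I j, assign α (side j t) ∈ M →
      len α (assign α (side j t)) j = 0) :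
    ∑ j, ∫ t in I j, ‖side j t - assign α (side j t)‖ ^ 2
      ≤ ∑ j, ∫ t in I j, ‖side j t - g j t‖ ^ 2 := by
  classical
  obtain ⟨s₀, hs₀⟩ := hS
  -- A null set still assigned to the deleted points; it is sent to the arbitrary point `s₀`.
  set Z : Fin 6 → Set ℝ := fun j => (Set.Icc 0 1 \ I j) ∩ {t | assign α (side j t) ∈ M} with hZ
  have hMm : ∀ j, MeasurableSet {t : ℝ | assign α (side j t) ∈ M} := fun j =>
    measurable_assign_side hα j M.measurableSet
  have hZm : ∀ j, MeasurableSet (Z j) := fun j =>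
    (measurableSet_Icc.diff (hI j)).inter (hMm j)
  have hZ0 : ∀ j, volume (Z j) = 0 := fun j => by
    refine measure_mono_null (t := ⋃ a ∈ M.filter (fun a => len α a j = 0), cell α a j) ?_ ?_
    · rintro t ⟨ht, htM⟩
      refine Set.mem_iUnion₂.2 ⟨assign α (side j t), ?_, ht.1, rfl⟩
      exact Finset.mem_filter.2 ⟨htM, hnull j t ht htM⟩
    · refine (measure_biUnion_null_iff (Finset.countable_toSet _)).2 fun a ha => ?_
      exact (measureReal_eq_zero_iff (volume_ne_top_of_subset (cell_subset α a j))).1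
        (Finset.mem_filter.1 ha).2
  have hc : (α \ M ∪ S).card ≤ n := by
    have h1 := Finset.card_union_le (α \ M) S
    have h2 := Finset.card_sdiff_add_card_eq_card hM
    have h3 := h.1
    omega
  have key := sum_setIntegral_le hα h hc
    (g := fun j t => if t ∈ I j then g j t else
      if assign α (side j t) ∈ M then s₀ else assign α (side j t))
    (fun j => Measurable.ite (hI j) (hg j)
      (Measurable.ite (hMm j) measurable_const (measurable_assign_side hα j)))
    (fun j t _ => by
      rw [Finset.mem_union, Finset.mem_sdiff]
      split_ifs with h1 h2
      · exact Or.inr (hgS j t h1)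
      · exact Or.inr hs₀
      · exact Or.inl ⟨assign_mem hα _, h2⟩)
    (E := fun j => I j ∪ Z j) (fun j => (hI j).union (hZm j))
    (fun j => Set.union_subset (hsub j) fun t ht => ht.1.1)
    (fun j t ht => by
      have h1 : t ∉ I j := fun h' => ht.2 (Or.inl h')
      have h2 : assign α (side j t) ∉ M := fun h' => ht.2 (Or.inr ⟨⟨ht.1, h1⟩, h'⟩)
      rw [if_neg h1, if_neg h2])
  have hae : ∀ j, (I j ∪ Z j : Set ℝ) =ᵐ[volume] I j := fun j =>
    union_ae_eq_left_of_ae_eq_empty (ae_eq_empty.2 (hZ0 j))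
  simp only [fun j (F : ℝ → ℝ) => setIntegral_congr_set (f := F) (hae j)] at key
  refine key.trans_eq (Finset.sum_congr rfl fun j _ => ?_)
  exact setIntegral_congr_fun (hI j) fun t ht => by simp only [if_pos ht]

/-- An interval can be cut into `k` cells of equal length. -/
lemma exists_quantizer (k : ℕ) (a : ℝ) {h : ℝ} (hh : 0 ≤ h) : ∃ (g : ℝ → ℝ) (S : Finset ℝ),
    Measurable g ∧ S.card ≤ k ∧ (∀ t ∈ Set.Ioc a (a + k * h), g t ∈ S) ∧
      IntegrableOn (fun t => (t - g t) ^ 2) (Set.Ioc a (a + k * h)) ∧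
      ∫ t in Set.Ioc a (a + k * h), (t - g t) ^ 2 = k * h ^ 3 / 12 := by
  classical
  induction k with
  | zero => exact ⟨fun _ => 0, ∅, measurable_const, by simp, by simp, by simp, by simp⟩
  | succ k ih =>
    obtain ⟨g, S, hg, hS, hgS, hi, hint⟩ := ih
    set b := a + k * h with hb
    have hab : a ≤ b := by have : 0 ≤ k * h := by positivity
                           linarith
    have hbe : a + (k + 1 : ℕ) * h = b + h := by push_cast; ring
    rw [hbe]
    have hun : Set.Ioc a (b + h) = Set.Ioc a b ∪ Set.Ioc b (b + h) :=
      (Set.Ioc_union_Ioc_eq_Ioc hab (by linarith)).symm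
    have c1 : Set.EqOn (fun t => (t - if t ≤ b then g t else b + h / 2) ^ 2)
        (fun t => (t - g t) ^ 2) (Set.Ioc a b) := fun t ht => by
      simp only [if_pos ht.2]
    have c2 : Set.EqOn (fun t => (t - if t ≤ b then g t else b + h / 2) ^ 2)
        (fun t => (t - (b + h / 2)) ^ 2) (Set.Ioc b (b + h)) := fun t ht => by
      simp only [if_neg (not_le.2 ht.1)]
    have i1 : IntegrableOn (fun t => (t - if t ≤ b then g t else b + h / 2) ^ 2)
        (Set.Ioc a b) := hi.congr_fun c1.symm measurableSet_Ioc
    have i2 : IntegrableOn (fun t => (t - if t ≤ b then g t else b + h / 2) ^ 2)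
        (Set.Ioc b (b + h)) :=
      IntegrableOn.congr_fun
        ((by fun_prop : Continuous fun t : ℝ => (t - (b + h / 2)) ^ 2).integrableOn_Ioc)
        c2.symm measurableSet_Ioc
    refine ⟨fun t => if t ≤ b then g t else b + h / 2, insert (b + h / 2) S,
      Measurable.ite measurableSet_Iic hg measurable_const,
      (Finset.card_insert_le _ _).trans (by omega), fun t ht => ?_, ?_, ?_⟩
    · dsimp only
      split_ifs with htb
      · exact Finset.mem_insert_of_mem (hgS t ⟨ht.1, htb⟩)
      · exact Finset.mem_insert_self _ _
    · rw [hun]; exact i1.union i2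
    · rw [hun, setIntegral_union (Set.Ioc_disjoint_Ioc_of_le le_rfl) measurableSet_Ioc i1 i2,
        setIntegral_congr_fun measurableSet_Ioc c1, hint,
        setIntegral_congr_fun measurableSet_Ioc c2,
        ← intervalIntegral.integral_of_le (by linarith),
        intervalIntegral.integral_comp_sub_right (fun x => x ^ 2), integral_pow]
      push_cast
      ring

/-- The part of a side served by one point costs at least as much as its length allows, in the
form of a lower bound that is linear in the length. -/
lemma le_setIntegral_norm_side_sub_sq {E : Set ℝ} (hE : MeasurableSet E)
    (hsub : E ⊆ Set.Icc (0 : ℝ) 1) (j : Fin 6) (a : Plane) {r : ℝ} (hr : 0 ≤ r) :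
    r ^ 2 * volume.real E - 4 * r ^ 3 / 3 ≤ ∫ t in E, ‖side j t - a‖ ^ 2 := by
  set c := inner ℝ (dir j) (a - vertex j) with hc
  have hcs := continuous_side j
  have hle : ∀ t, (t - c) ^ 2 ≤ ‖side j t - a‖ ^ 2 := fun t => by
    have h1 := abs_real_inner_le_norm (dir j) (side j t - a)
    have h2 : inner ℝ (dir j) (side j t - a) = t - c := by
      rw [hc, side_eq, show vertex j + t • dir j - a = t • dir j - (a - vertex j) by abel,
        inner_sub_right, inner_smul_right, inner_dir_self, mul_one]
    rw [norm_dir, one_mul, h2] at h1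
    rw [← sq_abs (t - c)]
    gcongr
  have hψ : Continuous fun t : ℝ => r ^ 2 - (t - c) ^ 2 := by fun_prop
  have hiE := integrableOn_of_subset_Icc hsub hψ
  have hI : IntegrableOn (fun t : ℝ => r ^ 2 - (t - c) ^ 2) (Set.Icc (c - r) (c + r)) :=
    hψ.integrableOn_Icc
  have hval : ∫ t in Set.Icc (c - r) (c + r), (r ^ 2 - (t - c) ^ 2) = 4 * r ^ 3 / 3 := by
    rw [integral_Icc_eq_integral_Ioc, ← intervalIntegral.integral_of_le (by linarith),
      intervalIntegral.integral_comp_sub_right (fun x => r ^ 2 - x ^ 2),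
      intervalIntegral.integral_sub (by simp)
        ((by fun_prop : Continuous fun x : ℝ => x ^ 2).intervalIntegrable _ _), intervalIntegral.integral_const,
      integral_pow]
    simp only [smul_eq_mul]
    push_cast
    ring
  -- The integral is largest when `E` is the interval where the integrand is nonnegative. The
  -- resulting bound is the tangent line of `L ^ 3 / 12` at `L = 2 * r`.
  have hbound : ∫ t in E, (r ^ 2 - (t - c) ^ 2) ≤ 4 * r ^ 3 / 3 := by
    rw [← hval, ← integral_inter_add_sdiff (t := Set.Icc (c - r) (c + r)) measurableSet_Icc hiE]
    have h1 : ∫ t in E \ Set.Icc (c - r) (c + r), (r ^ 2 - (t - c) ^ 2) ≤ 0 := by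
      refine setIntegral_nonpos (hE.diff measurableSet_Icc) fun t ht => ?_
      by_contra! hpos
      have := abs_lt_of_sq_lt_sq (sub_pos.1 hpos) hr
      rw [abs_lt] at this
      exact ht.2 ⟨by linarith, by linarith⟩
    have h2 : ∫ t in E ∩ Set.Icc (c - r) (c + r), (r ^ 2 - (t - c) ^ 2)
        ≤ ∫ t in Set.Icc (c - r) (c + r), (r ^ 2 - (t - c) ^ 2) := by
      refine setIntegral_mono_set hI ?_ (Eventually.of_forall Set.inter_subset_right)
      refine (ae_restrict_iff' measurableSet_Icc).2 (Eventually.of_forall fun t ht => ?_)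
      have : |t - c| ≤ r := abs_le.2 ⟨by linarith [ht.1], by linarith [ht.2]⟩
      exact sub_nonneg.2 (sq_le_sq' (abs_le.1 this).1 (abs_le.1 this).2)
    linarith
  have hfin := volume_ne_top_of_subset hsub
  have hsplit : ∫ t in E, (r ^ 2 - (t - c) ^ 2)
      = r ^ 2 * volume.real E - ∫ t in E, (t - c) ^ 2 := by
    have h1 : IntegrableOn (fun _ : ℝ => r ^ 2) E := integrableOn_const hfin
    have h2 : IntegrableOn (fun t : ℝ => (t - c) ^ 2) E :=
      integrableOn_of_subset_Icc hsub (by fun_prop)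
    rw [integral_sub h1 h2, setIntegral_const, smul_eq_mul, mul_comm]
  have hmono : ∫ t in E, (t - c) ^ 2 ≤ ∫ t in E, ‖side j t - a‖ ^ 2 :=
    setIntegral_mono_on (integrableOn_of_subset_Icc hsub (by fun_prop))
      (integrableOn_of_subset_Icc hsub (by fun_prop)) hE fun t _ => hle t
  linarith

/-- Along a side the difference of the squared distances to `b` and `d` is affine in the parameter.
-/
lemma norm_side_sub_lt_of_between {j : Fin 6} {b d : Plane} {m t θ : ℝ} (h0 : 0 ≤ θ) (h1 : θ < 1)
    (hm : ‖side j m - b‖ < ‖side j m - d‖) (ht : ‖side j t - b‖ ≤ ‖side j t - d‖) :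
    ‖side j (m + θ * (t - m)) - b‖ < ‖side j (m + θ * (t - m)) - d‖ := by
  have hm' : ‖side j m - b‖ ^ 2 < ‖side j m - d‖ ^ 2 := by gcongr
  have ht' : ‖side j t - b‖ ^ 2 ≤ ‖side j t - d‖ ^ 2 := by gcongr
  refine lt_of_pow_lt_pow_left₀ 2 (norm_nonneg _) ?_
  rw [norm_side_sub_sq_expand j _ m b, norm_side_sub_sq_expand j _ m d] at ht' ⊢
  have e1 := mul_le_mul_of_nonneg_left ht' h0
  have e2 := mul_lt_mul_of_pos_left hm' (sub_pos.2 h1)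
  linear_combination e1 + e2

lemma IsFineOptimal.assign_eq_of_between (h : IsFineOptimal n δ α) {j : Fin 6} {b : Plane}
    {m t θ : ℝ} (h0 : 0 ≤ θ) (h1 : θ < 1)
    (hm : ∀ d ∈ α, d ≠ b → ‖side j m - b‖ < ‖side j m - d‖) (ht : assign α (side j t) = b) :
    assign α (side j (m + θ * (t - m))) = b := by
  by_contra hne
  have hd := assign_mem h.nonempty (side j (m + θ * (t - m)))
  have hb : b ∈ α := ht ▸ assign_mem h.nonempty (side j t)
  have h2 := norm_side_sub_lt_of_between h0 h1 (hm _ hd hne)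
    (by have := norm_sub_assign_le (side j t) hd; rwa [ht] at this)
  exact absurd h2 (not_lt.2 (norm_sub_assign_le _ hb))

lemma cell_nonempty {a : Plane} {j : Fin 6} (h : 0 < len α a j) : (cell α a j).Nonempty := by
  rw [Set.nonempty_iff_ne_empty]
  intro h0
  rw [len, h0] at h
  simp at h

/-- On the side following a vertex, the part served by the corner point of the vertex is an
initial interval. -/
lemma IsFineOptimal.exists_start (h : IsFineOptimal n δ α) (hδ : δ ≤ 1 / 24) (i : Fin 6) :
    ∃ u, 0 ≤ u ∧ u ≤ 1 / 8 ∧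
      (∀ t ∈ Set.Icc (0 : ℝ) 1, t < u → Mixed α (assign α (side (i + 1) t)) i) ∧
      ∀ t ∈ Set.Icc (0 : ℝ) 1, u < t → ¬ Mixed α (assign α (side (i + 1) t)) i := by
  by_cases hex : ∃ b ∈ α, Mixed α b i
  · obtain ⟨b, hb, hi⟩ := hex
    obtain ⟨t₀, ht₀⟩ := cell_nonempty hi.2
    have hbdd : BddAbove (cell α b (i + 1)) := ⟨1, fun t ht => ht.1.2⟩
    have hV : side (i + 1) 0 = vertex (i + 1) := by simp [side_eq]
    refine ⟨sSup (cell α b (i + 1)), ht₀.1.1.trans (le_csSup hbdd ht₀),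
      csSup_le ⟨t₀, ht₀⟩ fun t ht => ?_, fun t ht htu => ?_, fun t ht htu hmix => ?_⟩
    -- The corner point is within `2 * δ` of the vertex and within `δ` of what it serves, and `3 * δ
    -- ≤ 1 / 8`.
    · have h1 := h.norm_vertex_sub_lt hδ hb hi
      have h2 := h.norm_sub_assign_lt (i + 1) t ht.1
      rw [ht.2] at h2
      have h3 := norm_sub_le_norm_sub_add_norm_sub (side (i + 1) t) b (side (i + 1) 0)
      rw [norm_side_sub_side, norm_sub_rev b, hV, sub_zero] at h3
      linarith [le_abs_self t]
    · obtain ⟨t₁, ht₁, hlt⟩ := exists_lt_of_lt_csSup ⟨t₀, ht₀⟩ htu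
      have ht₁0 : 0 < t₁ := ht.1.trans_lt hlt
      have := h.assign_eq_of_between (j := i + 1) (b := b) (m := 0) (t := t₁) (θ := t / t₁)
        (div_nonneg ht.1 ht₁0.le) ((div_lt_one ht₁0).2 hlt)
        (fun d hd hdb => by rw [hV]; exact h.norm_vertex_sub_lt_of_mixed hδ hb hi hd hdb) ht₁.2
      rw [sub_zero, zero_add, div_mul_cancel₀ _ ht₁0.ne'] at this
      rwa [this]
    · have := h.mixed_unique hδ (assign_mem h.nonempty _) hb hmix hi
      exact absurd (le_csSup hbdd (show t ∈ cell α b (i + 1) from ⟨ht, this⟩)) (not_le.2 htu)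
  · exact ⟨0, le_rfl, by norm_num, fun t ht htu => absurd ht.1 (not_le.2 htu),
      fun t _ _ hmix => hex ⟨_, assign_mem h.nonempty _, hmix⟩⟩

/-- On the side preceding a vertex, the part served by the corner point of the vertex is a
final interval. -/
lemma IsFineOptimal.exists_end (h : IsFineOptimal n δ α) (hδ : δ ≤ 1 / 24) (i : Fin 6) :
    ∃ v, 7 / 8 ≤ v ∧ v ≤ 1 ∧
      (∀ t ∈ Set.Icc (0 : ℝ) 1, v < t → Mixed α (assign α (side i t)) i) ∧
      ∀ t ∈ Set.Icc (0 : ℝ) 1, t < v → ¬ Mixed α (assign α (side i t)) i := by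
  by_cases hex : ∃ b ∈ α, Mixed α b i
  · obtain ⟨b, hb, hi⟩ := hex
    obtain ⟨t₀, ht₀⟩ := cell_nonempty hi.1
    have hbdd : BddBelow (cell α b i) := ⟨0, fun t ht => ht.1.1⟩
    have hV : side i 1 = vertex (i + 1) := by simp [side_eq_sub]
    refine ⟨sInf (cell α b i), le_csInf ⟨t₀, ht₀⟩ fun t ht => ?_,
      (csInf_le hbdd ht₀).trans ht₀.1.2, fun t ht htu => ?_, fun t ht htu hmix => ?_⟩
    · have h1 := h.norm_vertex_sub_lt hδ hb hi
      have h2 := h.norm_sub_assign_lt i t ht.1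
      rw [ht.2] at h2
      have h3 := norm_sub_le_norm_sub_add_norm_sub (side i t) b (side i 1)
      rw [norm_side_sub_side, norm_sub_rev b, hV] at h3
      linarith [neg_abs_le (t - 1)]
    · obtain ⟨t₁, ht₁, hlt⟩ := exists_lt_of_csInf_lt ⟨t₀, ht₀⟩ htu
      have ht₁0 : 0 < 1 - t₁ := by linarith [ht.2]
      have := h.assign_eq_of_between (j := i) (b := b) (m := 1) (t := t₁)
        (θ := (1 - t) / (1 - t₁))
        (div_nonneg (by linarith [ht.2]) ht₁0.le) ((div_lt_one ht₁0).2 (by linarith))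
        (fun d hd hdb => by rw [hV]; exact h.norm_vertex_sub_lt_of_mixed hδ hb hi hd hdb) ht₁.2
      have e : 1 + (1 - t) / (1 - t₁) * (t₁ - 1) = t := by field_simp; ring
      rw [e] at this
      rwa [this]
    · have := h.mixed_unique hδ (assign_mem h.nonempty _) hb hmix hi
      exact absurd (csInf_le hbdd (show t ∈ cell α b i from ⟨ht, this⟩)) (not_le.2 htu)
  · exact ⟨1, by norm_num, le_rfl, fun t ht htu => absurd ht.2 (not_le.2 htu),
      fun t _ _ hmix => hex ⟨_, assign_mem h.nonempty _, hmix⟩⟩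

lemma IsFineOptimal.len_le (h : IsFineOptimal n δ α) (hδ : 0 ≤ δ) (a : Plane) (j : Fin 6) :
    len α a j ≤ 2 * δ := by
  set c := inner ℝ (dir j) (a - vertex j) with hc
  have hsub : cell α a j ⊆ Set.Icc (c - δ) (c + δ) := fun t ht => by
    have h1 := abs_real_inner_le_norm (dir j) (side j t - a)
    have h2 : inner ℝ (dir j) (side j t - a) = t - c := by
      rw [hc, side_eq, show vertex j + t • dir j - a = t • dir j - (a - vertex j) by abel,
        inner_sub_right, inner_smul_right, inner_dir_self, mul_one]
    have h3 := h.norm_sub_assign_lt j t ht.1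
    rw [ht.2] at h3
    rw [norm_dir, one_mul, h2] at h1
    have h4 := abs_le.1 (h1.trans h3.le)
    exact ⟨by linarith, by linarith⟩
  calc len α a j ≤ volume.real (Set.Icc (c - δ) (c + δ)) := measureReal_mono hsub (by simp)
    _ = 2 * δ := by rw [Real.volume_real_Icc_of_le (by linarith)]; ring

/-- An interval of a side that is served by `m` points has length at most `2 * δ * m`, and costs
at least as much as its division into `m` equal cells. -/
lemma IsFineOptimal.interval_bounds (h : IsFineOptimal n δ α) (hδ : 0 ≤ δ) {j : Fin 6} {u v : ℝ}
    (hu : 0 ≤ u) (huv : u < v) (hv : v ≤ 1) {M : Finset Plane} (hM : M ⊆ α)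
    (hmem : ∀ t ∈ Set.Ioo u v, 0 < len α (assign α (side j t)) j → assign α (side j t) ∈ M) :
    v - u ≤ 2 * δ * M.card ∧ (v - u) ^ 3 / (12 * (M.card : ℝ) ^ 2)
      ≤ ∫ t in Set.Icc u v, ‖side j t - assign α (side j t)‖ ^ 2 := by
  set E : Plane → Set ℝ := fun a => Set.Ioo u v ∩ cell α a j with hE
  have hEm : ∀ a, MeasurableSet (E a) := fun a =>
    measurableSet_Ioo.inter (measurableSet_cell h.nonempty a j)
  have hsubI : Set.Ioo u v ⊆ Set.Icc (0 : ℝ) 1 := fun t ht =>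
    ⟨hu.trans ht.1.le, ht.2.le.trans hv⟩
  have hEsub : ∀ a, E a ⊆ Set.Icc (0 : ℝ) 1 := fun a => Set.inter_subset_left.trans hsubI
  have hun : Set.Ioo u v = ⋃ a ∈ α, E a := by
    ext t
    simp only [Set.mem_iUnion, exists_prop]
    exact ⟨fun ht => ⟨_, assign_mem h.nonempty _, ht, hsubI ht, rfl⟩, fun ⟨_, _, ht, _⟩ => ht⟩
  have hdisj : (α : Set Plane).PairwiseDisjoint E := fun a _ b _ hab =>
    Set.disjoint_left.2 fun t ht ht' => hab (ht.2.2.symm.trans ht'.2.2)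
  have hnull : ∀ a ∉ M, volume.real (E a) = 0 := fun a ha => by
    by_cases hlen : 0 < len α a j
    · have : E a = ∅ := by
        refine Set.eq_empty_iff_forall_notMem.2 fun t ht => ha ?_
        have := hmem t ht.1
        rw [ht.2.2] at this
        exact this hlen
      simp [this]
    · refine le_antisymm ((measureReal_mono Set.inter_subset_right
        (volume_ne_top_of_subset (cell_subset α a j))).trans (not_lt.1 hlen)) measureReal_nonneg
  have hlen : v - u = ∑ a ∈ M, volume.real (E a) := by
    rw [Finset.sum_subset hM fun a _ ha => hnull a ha,
      ← measureReal_biUnion_finset hdisj (fun a _ => hEm a)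
        (fun a _ => volume_ne_top_of_subset (hEsub a)), ← hun, Real.volume_real_Ioo_of_le huv.le]
  have hle : v - u ≤ 2 * δ * M.card := by
    rw [hlen, mul_comm, ← nsmul_eq_mul]
    refine Finset.sum_le_card_nsmul _ _ _ fun a _ => ?_
    exact (measureReal_mono Set.inter_subset_right
      (volume_ne_top_of_subset (cell_subset α a j))).trans (h.len_le hδ a j)
  refine ⟨hle, ?_⟩
  have hm0 : 0 < (M.card : ℝ) := by
    rcases (Nat.cast_nonneg (α := ℝ) M.card).eq_or_lt with h0 | h0
    · rw [← h0, mul_zero] at hle; linarith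
    · exact h0
  -- Half the length of an equal cell: at this tangent point the linear bounds sum exactly to the
  -- cost of equal cells.
  set r := (v - u) / (2 * M.card) with hr
  have hr0 : 0 ≤ r := div_nonneg (by linarith) (by linarith)
  have hint := integrableOn_cost j (measurable_assign_side h.nonempty j) (β := α)
    fun t _ => assign_mem h.nonempty _
  have hcell : ∀ a, ∫ t in E a, ‖side j t - assign α (side j t)‖ ^ 2
      = ∫ t in E a, ‖side j t - a‖ ^ 2 := fun a =>
    setIntegral_congr_fun (hEm a) fun t ht => by simp only [ht.2.2]
  calc (v - u) ^ 3 / (12 * (M.card : ℝ) ^ 2)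
      = ∑ a ∈ M, (r ^ 2 * volume.real (E a) - 4 * r ^ 3 / 3) := by
        rw [Finset.sum_sub_distrib, ← Finset.mul_sum, ← hlen, Finset.sum_const, nsmul_eq_mul, hr]
        generalize v - u = T
        generalize (M.card : ℝ) = m at hm0
        field_simp
        ring
    _ ≤ ∑ a ∈ M, ∫ t in E a, ‖side j t - a‖ ^ 2 := Finset.sum_le_sum fun a _ =>
        le_setIntegral_norm_side_sub_sq (hEm a) (hEsub a) j a hr0
    _ ≤ ∑ a ∈ α, ∫ t in E a, ‖side j t - a‖ ^ 2 :=
        Finset.sum_le_sum_of_subset_of_nonneg hM fun a _ _ =>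
          integral_nonneg fun _ => by positivity
    _ = ∫ t in Set.Icc u v, ‖side j t - assign α (side j t)‖ ^ 2 := by
        rw [integral_Icc_eq_integral_Ioo, hun, integral_biUnion_finset _ (fun a _ => hEm a) hdisj
          (fun a _ => hint.mono_set (hEsub a))]
        exact Finset.sum_congr rfl fun a _ => (hcell a).symm

/-! ### The competitor with a corner point, and existence of mixed points -/

lemma exists_side_quantizer (j : Fin 6) {a b : ℝ} (hab : a ≤ b) {k : ℕ} (hk : 0 < k) :
    ∃ (g : ℝ → Plane) (S : Finset Plane), Measurable g ∧ S.card ≤ k ∧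
      (∀ t ∈ Set.Ioc a b, g t ∈ S) ∧
      IntegrableOn (fun t => ‖side j t - g t‖ ^ 2) (Set.Ioc a b) ∧
      ∫ t in Set.Ioc a b, ‖side j t - g t‖ ^ 2 = (b - a) ^ 3 / (12 * (k : ℝ) ^ 2) := by
  classical
  have hk' : (0 : ℝ) < k := by exact_mod_cast hk
  obtain ⟨g, S, hg, hS, hgS, hi, hint⟩ := exists_quantizer k a
    (h := (b - a) / k) (div_nonneg (sub_nonneg.2 hab) hk'.le)
  rw [mul_div_cancel₀ _ hk'.ne', add_sub_cancel] at hgS hi hint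
  refine ⟨fun t => side j (g t), S.image (side j), (measurable_side j).comp hg,
    Finset.card_image_le.trans hS, fun t ht => Finset.mem_image_of_mem _ (hgS t ht), ?_, ?_⟩
  · simpa only [norm_side_sub_side_sq] using hi
  · simp only [norm_side_sub_side_sq, hint]
    field_simp

lemma integral_corner (c : ℝ) :
    ∫ s in (0 : ℝ)..c, (c ^ 2 / 16 - c / 4 * s + s ^ 2) = 13 * c ^ 3 / 48 := by
  rw [intervalIntegral.integral_add
      ((by fun_prop : Continuous fun s : ℝ => c ^ 2 / 16 - c / 4 * s).intervalIntegrable _ _)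
      ((by fun_prop : Continuous fun s : ℝ => s ^ 2).intervalIntegrable _ _),
    intervalIntegral.integral_sub (by simp)
      ((by fun_prop : Continuous fun s : ℝ => c / 4 * s).intervalIntegrable _ _),
    intervalIntegral.integral_const, intervalIntegral.integral_const_mul, integral_id,
    integral_pow]
  simp only [smul_eq_mul]
  push_cast
  ring

/-- The point `cornerPt i (c / 4) (c / 4)` is the centroid of the two segments of length `c` at the
vertex. -/
lemma setIntegral_corner_start (i : Fin 6) {c : ℝ} (hc : 0 ≤ c) :
    ∫ t in Set.Ioc 0 c, ‖side (i + 1) t - cornerPt i (c / 4) (c / 4)‖ ^ 2 = 13 * c ^ 3 / 48 := by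
  rw [← integral_corner c, ← intervalIntegral.integral_of_le hc]
  congr 1
  ext t
  rw [side_succ_eq_cornerPt, norm_cornerPt_sub_sq]
  ring

lemma setIntegral_corner_end (i : Fin 6) {c : ℝ} (hc : 0 ≤ c) :
    ∫ t in Set.Ioc (1 - c) 1, ‖side i t - cornerPt i (c / 4) (c / 4)‖ ^ 2 = 13 * c ^ 3 / 48 := by
  have h := intervalIntegral.integral_comp_sub_left (a := 1 - c) (b := 1)
    (fun s => c ^ 2 / 16 - c / 4 * s + s ^ 2) 1
  rw [sub_self, sub_sub_cancel, integral_corner] at h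
  rw [← h, ← intervalIntegral.integral_of_le (by linarith)]
  congr 1
  ext t
  rw [side_eq_cornerPt, norm_cornerPt_sub_sq]
  ring

lemma exists_competitor_end (i : Fin 6) {u c : ℝ} (hc : 0 ≤ c) (huc : u ≤ 1 - c) {k : ℕ}
    (hk : 0 < k) : ∃ (g : ℝ → Plane) (S : Finset Plane), Measurable g ∧ S.card ≤ k ∧
      (∀ t, g t = cornerPt i (c / 4) (c / 4) ∨ g t ∈ S) ∧
      ∫ t in Set.Icc u 1, ‖side i t - g t‖ ^ 2
        = (1 - u - c) ^ 3 / (12 * (k : ℝ) ^ 2) + 13 * c ^ 3 / 48 := by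
  classical
  obtain ⟨g, S, hg, hS, hgS, hi, hint⟩ := exists_side_quantizer i huc hk
  have hcs := continuous_side i
  set K := cornerPt i (c / 4) (c / 4)
  have c1 : Set.EqOn (fun t => ‖side i t - if t ∈ Set.Ioc u (1 - c) then g t else K‖ ^ 2)
      (fun t => ‖side i t - g t‖ ^ 2) (Set.Ioc u (1 - c)) := fun t ht => by
    simp only [if_pos ht]
  have c2 : Set.EqOn (fun t => ‖side i t - if t ∈ Set.Ioc u (1 - c) then g t else K‖ ^ 2)
      (fun t => ‖side i t - K‖ ^ 2) (Set.Ioc (1 - c) 1) := fun t ht => by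
    have : t ∉ Set.Ioc u (1 - c) := fun h => absurd h.2 (not_le.2 ht.1)
    simp only [if_neg this]
  refine ⟨fun t => if t ∈ Set.Ioc u (1 - c) then g t else K, S,
    Measurable.ite measurableSet_Ioc hg measurable_const, hS, fun t => ?_, ?_⟩
  · dsimp only
    split_ifs with h
    exacts [Or.inr (hgS t h), Or.inl rfl]
  · rw [integral_Icc_eq_integral_Ioc, ← Set.Ioc_union_Ioc_eq_Ioc huc (by linarith : 1 - c ≤ 1),
      setIntegral_union (Set.Ioc_disjoint_Ioc_of_le le_rfl) measurableSet_Ioc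
        (hi.congr_fun c1.symm measurableSet_Ioc)
        (IntegrableOn.congr_fun
          ((by fun_prop : Continuous fun t => ‖side i t - K‖ ^ 2).integrableOn_Ioc)
          c2.symm measurableSet_Ioc),
      setIntegral_congr_fun measurableSet_Ioc c1, setIntegral_congr_fun measurableSet_Ioc c2,
      hint, setIntegral_corner_end i hc]
    ring

lemma exists_competitor_start (i : Fin 6) {v c : ℝ} (hc : 0 ≤ c) (hcv : c ≤ v) {k : ℕ}
    (hk : 0 < k) : ∃ (g : ℝ → Plane) (S : Finset Plane), Measurable g ∧ S.card ≤ k ∧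
      (∀ t, g t = cornerPt i (c / 4) (c / 4) ∨ g t ∈ S) ∧
      ∫ t in Set.Icc 0 v, ‖side (i + 1) t - g t‖ ^ 2
        = (v - c) ^ 3 / (12 * (k : ℝ) ^ 2) + 13 * c ^ 3 / 48 := by
  classical
  obtain ⟨g, S, hg, hS, hgS, hi, hint⟩ := exists_side_quantizer (i + 1) hcv hk
  have hcs := continuous_side (i + 1)
  set K := cornerPt i (c / 4) (c / 4)
  have c1 : Set.EqOn (fun t => ‖side (i + 1) t - if t ∈ Set.Ioc c v then g t else K‖ ^ 2)
      (fun t => ‖side (i + 1) t - g t‖ ^ 2) (Set.Ioc c v) := fun t ht => by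
    simp only [if_pos ht]
  have c2 : Set.EqOn (fun t => ‖side (i + 1) t - if t ∈ Set.Ioc c v then g t else K‖ ^ 2)
      (fun t => ‖side (i + 1) t - K‖ ^ 2) (Set.Ioc 0 c) := fun t ht => by
    have : t ∉ Set.Ioc c v := fun h => absurd ht.2 (not_le.2 h.1)
    simp only [if_neg this]
  refine ⟨fun t => if t ∈ Set.Ioc c v then g t else K, S,
    Measurable.ite measurableSet_Ioc hg measurable_const, hS, fun t => ?_, ?_⟩
  · dsimp only
    split_ifs with h
    exacts [Or.inr (hgS t h), Or.inl rfl]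
  · rw [integral_Icc_eq_integral_Ioc, ← Set.Ioc_union_Ioc_eq_Ioc hc hcv,
      setIntegral_union (Set.Ioc_disjoint_Ioc_of_le le_rfl) measurableSet_Ioc
        (IntegrableOn.congr_fun
          ((by fun_prop : Continuous fun t => ‖side (i + 1) t - K‖ ^ 2).integrableOn_Ioc)
          c2.symm measurableSet_Ioc)
        (hi.congr_fun c1.symm measurableSet_Ioc),
      setIntegral_congr_fun measurableSet_Ioc c1, setIntegral_congr_fun measurableSet_Ioc c2,
      hint, setIntegral_corner_start i hc]
    ring

/-- Cells of equal length up to the vertex are not optimal. -/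
lemma false_of_no_corner {m k T₁ T₂ : ℝ} (hm : 11 ≤ m) (hk : 11 ≤ k) (hT₂ : 0 < T₂)
    (hle : T₂ / k ≤ T₁ / m)
    (h : T₁ ^ 3 / (12 * m ^ 2) + T₂ ^ 3 / (12 * k ^ 2)
      ≤ (T₁ - T₂ / k / 2) ^ 3 / (12 * m ^ 2) + 13 * (T₂ / k / 2) ^ 3 / 48
        + ((T₂ - T₂ / k / 2) ^ 3 / (12 * (k - 1) ^ 2) + 13 * (T₂ / k / 2) ^ 3 / 48)) : False := by
  have hk0 : 0 < k := by linarith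
  have hm0 : 0 < m := by linarith
  have hk1 : 0 < k - 1 := by linarith
  obtain ⟨a, ha⟩ : ∃ a, a = T₁ / m := ⟨_, rfl⟩
  obtain ⟨l, hl⟩ : ∃ l, l = T₂ / k := ⟨_, rfl⟩
  have hl0 : 0 < l := hl ▸ div_pos hT₂ hk0
  obtain ⟨x, hx⟩ : ∃ x, x = m⁻¹ := ⟨_, rfl⟩
  obtain ⟨y, hy⟩ : ∃ y, y = (k - 1)⁻¹ := ⟨_, rfl⟩
  have hx0 : 0 < x := hx ▸ inv_pos.2 hm0
  have hy0 : 0 < y := hy ▸ inv_pos.2 hk1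
  have hx1 : x ≤ 1 / 11 := by rw [hx, inv_le_comm₀ hm0 (by norm_num)]; linarith
  have hy1 : y ≤ 1 / 10 := by rw [hy, inv_le_comm₀ hk1 (by norm_num)]; linarith
  have hT₁e : T₁ = m * a := by rw [ha]; field_simp
  have hT₂e : T₂ = k * l := by rw [hl]; field_simp
  have e1 : (m * a) ^ 3 / (12 * m ^ 2) - (m * a - l / 2) ^ 3 / (12 * m ^ 2)
      = (3 * a ^ 2 * l / 2 - 3 * a * l ^ 2 / 4 * x + l ^ 3 / 8 * x ^ 2) / 12 := by
    rw [hx]; field_simp; ring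
  have e2 : (k * l - l / 2) ^ 3 / (12 * (k - 1) ^ 2) - (k * l) ^ 3 / (12 * k ^ 2)
      = l ^ 3 * (1 / 2 + 3 / 4 * y + y ^ 2 / 8) / 12 := by
    rw [hy]; field_simp; ring
  rw [← ha, ← hl] at hle
  rw [← hl, hT₁e, hT₂e] at h
  -- Savings of the first side against losses of the second side and the corner, scaled by `12`.
  -- Since `l ≤ a`, this contradicts `3 / 2 - 3 / 44 > 1 / 2 + 3 / 40 + 1 / 800 + 13 / 16`.
  have h2 : 3 * a ^ 2 * l / 2 - 3 * a * l ^ 2 / 4 * x + l ^ 3 / 8 * x ^ 2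
      ≤ l ^ 3 * (1 / 2 + 3 / 4 * y + y ^ 2 / 8) + 13 / 16 * l ^ 3 := by
    linear_combination 12 * h - 12 * e1 + 12 * e2
  have hl3 : 0 < l ^ 3 := by positivity
  have a0 : 0 < a := hl0.trans_le hle
  have f1 : l ^ 3 * (1 / 2 + 3 / 4 * y + y ^ 2 / 8)
      ≤ l ^ 3 * (1 / 2 + 3 / 4 * (1 / 10) + (1 / 10) ^ 2 / 8) := by gcongr
  have f2 : 3 * a * l ^ 2 / 4 * x ≤ 3 * a * l ^ 2 / 4 * (1 / 11) := by gcongr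
  have f3 : 0 ≤ l ^ 3 / 8 * x ^ 2 := by positivity
  have f4 : a * l ^ 2 ≤ a ^ 2 * l := by
    have : a * l * l ≤ a * l * a := by gcongr
    linarith
  have f5 : l ^ 3 ≤ a ^ 2 * l := by
    have : l * l * l ≤ a * a * l := by gcongr
    linarith
  linarith

lemma ite_sum_eq (i : Fin 6) (F : Fin 6 → Set ℝ → ℝ) (hF : ∀ j, F j ∅ = 0) (A B : Set ℝ) :
    ∑ j, F j (if j = i then A else if j = i + 1 then B else ∅) = F i A + F (i + 1) B := by
  rw [Finset.sum_eq_add i (i + 1) (ne_add_one i)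
    (fun k _ hk => by rw [if_neg hk.1, if_neg hk.2, hF]) (by simp) (by simp),
    if_pos rfl, if_neg (ne_add_one i).symm, if_pos rfl]

/-- Every vertex has a point of `α` that serves both of its sides. -/
lemma IsFineOptimal.exists_mixed (h : IsFineOptimal n δ α) (hδ0 : 0 < δ) (hδ : δ ≤ 1 / 24)
    (i : Fin 6) : ∃ a ∈ α, Mixed α a i := by
  classical
  by_contra! hno
  -- `Mixed α a i` refers to `vertex (i + 1)`, so the corner at the start of side `i` has index `i -
  -- 1`.
  obtain ⟨i', rfl⟩ : ∃ i', i = i' + 1 := ⟨i - 1, by simp⟩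
  obtain ⟨u, hu0, hu1, hu, hu'⟩ := h.exists_start hδ i'
  obtain ⟨v, hv0, hv1, hv, hv'⟩ := h.exists_end hδ (i' + 1 + 1)
  set i := i' + 1 with hi
  set M₁ := α.filter fun a => 0 < len α a i ∧ ¬ Mixed α a i' with hM₁
  set M₂ := α.filter fun a => 0 < len α a (i + 1) ∧ ¬ Mixed α a (i + 1) with hM₂
  have hsub₁ : M₁ ⊆ α := Finset.filter_subset _ _
  have hsub₂ : M₂ ⊆ α := Finset.filter_subset _ _
  have hpure₁ : ∀ a ∈ M₁, ∀ k, k ≠ i → len α a k = 0 := fun a ha => by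
    obtain ⟨haα, hai, hmix⟩ := Finset.mem_filter.1 ha
    rcases h.pure_or_mixed hδ haα with ⟨j, hj, hk⟩ | ⟨l, hl⟩
    · have : i = j := by by_contra hne; exact hai.ne' (hk i hne)
      rwa [this]
    · exfalso
      by_cases e1 : i = l
      · exact hno a haα (e1 ▸ hl)
      by_cases e2 : i = l + 1
      · have : i' = l := by rw [hi] at e2; exact add_right_cancel e2
        exact hmix (this ▸ hl)
      · exact hai.ne' (h.len_eq_zero_of_mixed hδ haα hl e1 e2)
  have hpure₂ : ∀ a ∈ M₂, ∀ k, k ≠ i + 1 → len α a k = 0 := fun a ha => by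
    obtain ⟨haα, hai, hmix⟩ := Finset.mem_filter.1 ha
    rcases h.pure_or_mixed hδ haα with ⟨j, hj, hk⟩ | ⟨l, hl⟩
    · have : i + 1 = j := by by_contra hne; exact hai.ne' (hk _ hne)
      rwa [this]
    · exfalso
      by_cases e1 : i + 1 = l
      · exact hmix (e1 ▸ hl)
      by_cases e2 : i + 1 = l + 1
      · exact hno a haα (add_right_cancel e2 ▸ hl)
      · exact hai.ne' (h.len_eq_zero_of_mixed hδ haα hl e1 e2)
  have hdisj : Disjoint M₁ M₂ := Finset.disjoint_left.2 fun a h1 h2 =>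
    (Finset.mem_filter.1 h2).2.1.ne' (hpure₁ a h1 _ (ne_add_one i).symm)
  have b₁ := h.interval_bounds hδ0.le (j := i) hu0 (by linarith : u < 1) le_rfl hsub₁
    fun t ht hlen => Finset.mem_filter.2 ⟨assign_mem h.nonempty _, hlen,
      hu' t ⟨hu0.trans ht.1.le, ht.2.le⟩ ht.1⟩
  have b₂ := h.interval_bounds hδ0.le (j := i + 1) le_rfl (by linarith : 0 < v) hv1 hsub₂
    fun t ht hlen => Finset.mem_filter.2 ⟨assign_mem h.nonempty _, hlen, fun hm =>
      hv' t ⟨ht.1.le, ht.2.le.trans hv1⟩ ht.2 hm⟩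
  have hδ' : 2 * δ ≤ 1 / 12 := by linarith
  -- The interval has length at least `7 / 8` and each cell at most `1 / 12`, so ten points are not
  -- enough.
  have hcard₁ : (11 : ℝ) ≤ M₁.card := by
    have h1 : 2 * δ * (M₁.card : ℝ) ≤ 1 / 12 * M₁.card := by gcongr
    have h2 : (10 : ℝ) < M₁.card := by linarith [b₁.1]
    exact_mod_cast h2
  have hcard₂ : (11 : ℝ) ≤ M₂.card := by
    have h1 : 2 * δ * (M₂.card : ℝ) ≤ 1 / 12 * M₂.card := by gcongr
    have h2 : (10 : ℝ) < M₂.card := by linarith [b₂.1]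
    exact_mod_cast h2
  have step : ∀ (c : ℝ) (k₁ k₂ : ℕ), 0 ≤ c → u ≤ 1 - c → c ≤ v → 0 < k₁ → 0 < k₂ →
      k₁ + k₂ + 1 ≤ M₁.card + M₂.card →
      (1 - u) ^ 3 / (12 * (M₁.card : ℝ) ^ 2) + (v - 0) ^ 3 / (12 * (M₂.card : ℝ) ^ 2)
        ≤ (1 - u - c) ^ 3 / (12 * (k₁ : ℝ) ^ 2) + 13 * c ^ 3 / 48
          + ((v - c) ^ 3 / (12 * (k₂ : ℝ) ^ 2) + 13 * c ^ 3 / 48) := by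
    intro c k₁ k₂ hc huc hcv hk₁ hk₂ hk
    obtain ⟨g₁, S₁, hg₁, hS₁, hgS₁, hint₁⟩ := exists_competitor_end i hc huc hk₁
    obtain ⟨g₂, S₂, hg₂, hS₂, hgS₂, hint₂⟩ := exists_competitor_start i hc hcv hk₂
    set K := cornerPt i (c / 4) (c / 4)
    have hScard : (insert K (S₁ ∪ S₂)).card ≤ (M₁ ∪ M₂).card := by
      rw [Finset.card_union_of_disjoint hdisj]
      have h1 := Finset.card_insert_le K (S₁ ∪ S₂)
      have h2 := Finset.card_union_le S₁ S₂
      omega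
    have key := sum_setIntegral_le_of_replace h.nonempty h.opt (Finset.union_subset hsub₁ hsub₂)
      (Finset.insert_nonempty K (S₁ ∪ S₂)) hScard
      (I := fun j => if j = i then Set.Icc u 1 else if j = i + 1 then Set.Icc 0 v else ∅)
      (g := fun j => if j = i then g₁ else g₂)
      (fun j => by split_ifs; exacts [measurableSet_Icc, measurableSet_Icc, .empty])
      (fun j => by
        split_ifs
        exacts [Set.Icc_subset_Icc_left hu0, Set.Icc_subset_Icc_right hv1, Set.empty_subset _])
      (fun j => by split_ifs; exacts [hg₁, hg₂])
      (fun j t _ => by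
        have hins : ∀ {p : Plane}, p = K ∨ p ∈ S₁ ∪ S₂ → p ∈ insert K (S₁ ∪ S₂) :=
          Finset.mem_insert.2
        split_ifs
        · exact hins ((hgS₁ t).imp_right fun h' => Finset.mem_union_left _ h')
        · exact hins ((hgS₂ t).imp_right fun h' => Finset.mem_union_right _ h'))
      (fun j t ht hM => by
        have hcell : t ∈ cell α (assign α (side j t)) j := ⟨ht.1, rfl⟩
        rcases Finset.mem_union.1 hM with hM | hM
        · by_cases hj : j = i
          · exfalso
            subst hj
            rw [if_pos rfl] at ht
            have htu : t < u := not_le.1 fun h' => ht.2 ⟨h', ht.1.2⟩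
            exact (Finset.mem_filter.1 hM).2.2 (hu t ht.1 htu)
          · exact hpure₁ _ hM j hj
        · by_cases hj : j = i + 1
          · exfalso
            subst hj
            rw [if_neg (ne_add_one i).symm, if_pos rfl] at ht
            have htv : v < t := not_le.1 fun h' => ht.2 ⟨ht.1.1, h'⟩
            exact (Finset.mem_filter.1 hM).2.2 (hv t ht.1 htv)
          · exact hpure₂ _ hM j hj)
    rw [ite_sum_eq i (fun j E => ∫ t in E, ‖side j t - assign α (side j t)‖ ^ 2) (by simp),
      ite_sum_eq i (fun j E => ∫ t in E, ‖side j t - (if j = i then g₁ else g₂) t‖ ^ 2)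
        (by simp)] at key
    simp only [if_true, if_neg (ne_add_one i).symm, hint₁, hint₂] at key
    exact (add_le_add b₁.2 b₂.2).trans key
  have half : ∀ {T k : ℝ}, 0 < T → T ≤ 1 → 11 ≤ k → 0 ≤ T / k / 2 ∧ T / k / 2 ≤ 1 / 22 :=
    fun hT hT1 hk => by
      have hk0 := lt_of_lt_of_le (by norm_num : (0 : ℝ) < 11) hk
      refine ⟨by positivity, ?_⟩
      rw [div_div, div_le_div_iff₀ (by positivity) (by norm_num)]
      linarith
  have hn₁ : 11 ≤ M₁.card := by exact_mod_cast hcard₁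
  have hn₂ : 11 ≤ M₂.card := by exact_mod_cast hcard₂
  have hu1' : 0 < 1 - u := by linarith
  have hv0' : 0 < v := by linarith
  -- The point to spare comes from the side with the shorter cells, and `c` is half such a cell.
  rcases le_total (v / M₂.card) ((1 - u) / M₁.card) with hle | hle
  · obtain ⟨c0, c1⟩ := half hv0' hv1 hcard₂
    have := step (v / M₂.card / 2) M₁.card (M₂.card - 1) c0 (by linarith) (by linarith)
      (by omega) (by omega) (by omega)
    rw [Nat.cast_sub (by omega), Nat.cast_one, sub_zero] at this
    exact false_of_no_corner hcard₁ hcard₂ hv0' hle this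
  · obtain ⟨c0, c1⟩ := half hu1' (by linarith) hcard₁
    have := step ((1 - u) / M₁.card / 2) (M₁.card - 1) M₂.card c0 (by linarith) (by linarith)
      (by omega) (by omega) (by omega)
    rw [Nat.cast_sub (by omega), Nat.cast_one, sub_zero] at this
    exact false_of_no_corner hcard₂ hcard₁ hu1' hle (by linarith)

/-! ### The corner points and the conclusion -/

open Classical in
/-- The point of `α` that serves both sides at the `i`th vertex. -/
noncomputable def cornerPoint (α : Finset Plane) (i : Fin 6) : Plane :=
  if h : ∃ a ∈ α, Mixed α a (i - 1) then h.choose else 0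

lemma IsFineOptimal.cornerPoint_spec (h : IsFineOptimal n δ α) (hδ0 : 0 < δ) (hδ : δ ≤ 1 / 24)
    (i : Fin 6) : cornerPoint α i ∈ α ∧ Mixed α (cornerPoint α i) (i - 1) := by
  have hex := h.exists_mixed hδ0 hδ (i - 1)
  rw [cornerPoint, dif_pos hex]
  exact hex.choose_spec

lemma IsFineOptimal.dist_cornerPoint_lt (h : IsFineOptimal n δ α) (hδ0 : 0 < δ)
    (hδ : δ ≤ 1 / 24) (i : Fin 6) : dist (cornerPoint α i) (vertex i) < 2 * δ := by
  obtain ⟨h1, h2⟩ := h.cornerPoint_spec hδ0 hδ i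
  have := h.norm_vertex_sub_lt hδ h1 h2
  rwa [sub_add_cancel, ← dist_eq_norm, dist_comm] at this

lemma IsFineOptimal.mixed_mem_interior (h : IsFineOptimal n δ α) (hδ : δ ≤ 1 / 24) {a : Plane}
    (ha : a ∈ α) {i : Fin 6} (hi : Mixed α a i) : a ∈ interior region := by
  obtain ⟨x, y, hxy, hx, hy, hxq, hyq⟩ := h.exists_mixed_coords hδ ha hi
  have h1 := h.norm_vertex_sub_lt hδ ha hi
  have h2 : ‖vertex (i + 1) - a‖ ^ 2 < (2 * δ) ^ 2 := by gcongr
  rw [hxy, vertex_eq_cornerPt, norm_cornerPt_sub_sq] at h2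
  have h0 : 0 < 2 * δ := (norm_nonneg _).trans_lt h1
  have h3 : (2 * δ) ^ 2 ≤ (1 / 12) ^ 2 := by
    gcongr
    linarith
  rw [hxy]
  refine cornerPt_mem_interior i hx hy ?_
  -- `(x + y) ^ 2 ≤ 4 * (x ^ 2 + y ^ 2 - x * y)` gives `x + y < 1 / 6`.
  nlinarith [sq_nonneg (x - y)]

lemma add_two_ne (i : Fin 6) : i + 1 + 1 ≠ i := by decide +revert

lemma IsFineOptimal.mixed_index_unique (h : IsFineOptimal n δ α) (hδ : δ ≤ 1 / 24) {a : Plane}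
    (ha : a ∈ α) {i j : Fin 6} (hi : Mixed α a i) (hj : Mixed α a j) : i = j := by
  by_contra hne
  by_cases h1 : j = i + 1
  · subst h1
    exact hj.2.ne' (h.len_eq_zero_of_mixed hδ ha hi (add_two_ne i)
      (ne_add_one (i + 1)).symm)
  · exact hj.1.ne' (h.len_eq_zero_of_mixed hδ ha hi (Ne.symm hne) h1)

end HexQuant

theorem mainTheorem8 :
    ∃ (N : ℕ) (corner : Finset HexQuant.Plane → Fin 6 → HexQuant.Plane),
      (∀ n : ℕ, N ≤ n → ∀ α : Finset HexQuant.Plane,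
        HexQuant.IsOptimalMeans HexQuant.uniformDist n α →
          Function.Injective (corner α) ∧
          (∀ i : Fin 6, corner α i ∈ α ∧ corner α i ∈ interior HexQuant.region) ∧
          (∀ x ∈ α, x ∉ Set.range (corner α) → x ∈ HexQuant.boundary)) ∧
      (∀ ε : ℝ, 0 < ε → ∃ M : ℕ, ∀ n : ℕ, M ≤ n → ∀ α : Finset HexQuant.Plane,
        HexQuant.IsOptimalMeans HexQuant.uniformDist n α →
          ∀ i : Fin 6, dist (corner α i) (HexQuant.vertex i) < ε) := by
  have hδ0 : (0 : ℝ) < 1 / 24 := by norm_num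
  obtain ⟨N, hN⟩ := HexQuant.exists_isFineOptimal hδ0
  -- The choice `cornerPoint` depends on `α` alone, not on `δ`, so the points found for `δ = 1 / 24`
  -- are also those that converge.
  refine ⟨N, HexQuant.cornerPoint, fun n hn α hα => ?_, fun ε hε => ?_⟩
  · have h := hN n hn α hα
    have hspec := h.cornerPoint_spec hδ0 le_rfl
    refine ⟨fun i j hij => ?_, fun i => ⟨(hspec i).1,
      h.mixed_mem_interior le_rfl (hspec i).1 (hspec i).2⟩, fun x hx hxr => ?_⟩
    · have h1 := (hspec i).2
      rw [hij] at h1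
      exact sub_left_injective (h.mixed_index_unique le_rfl (hspec j).1 h1 (hspec j).2)
    · rcases h.pure_or_mixed le_rfl hx with ⟨j, hj, hk⟩ | ⟨i, hi⟩
      · rw [h.eq_side_of_pure hx hj hk]
        exact HexQuant.side_mem_boundary j (HexQuant.mid_mem_Icc hj)
      · refine absurd ⟨i + 1, ?_⟩ hxr
        have h1 := hspec (i + 1)
        rw [add_sub_cancel_right] at h1
        exact h.mixed_unique le_rfl h1.1 hx h1.2 hi
  · have hδ : 0 < min (1 / 24) (ε / 2) := lt_min hδ0 (by linarith)
    obtain ⟨M, hM⟩ := HexQuant.exists_isFineOptimal hδ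
    refine ⟨M, fun n hn α hα i => ?_⟩
    have := (hM n hn α hα).dist_cornerPoint_lt hδ (min_le_left _ _) i
    linarith [min_le_right (1 / 24 : ℝ) (ε / 2)]
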